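/- An instance of Periodic Upper-Bounded Temporal Tree Realization (TTR) consists of a tree $G=(V,E)$ with $V=\{v_1,\dots,v_n\}$, an $n\times n$ matrix $D$ of positive integers, and a positive integer $\Delta$. For a labeling $\lambda:E\to\{1,\dots,\Delta\}$, a temporal path from $u$ to $v$ is a path of $G$ from $u$ to $v$ with edges $e_1,\dots,e_k$ together with times $t_1<\dots<t_k$ such that $t_i\in\{\lambda(e_i)+j\Delta : j\ge 0\}$ for every $i$; its duration is $t_k-t_1+1$ (and $0$ if $k=0$), and it is fastest if no temporal path from $u$ to $v$ has a smaller duration. The question is whether there is a labeling $\lambda:E\to\{1,\dots,\Delta\}$ such that, for all $i,j$, the duration of a fastest temporal path from $v_i$ to $v_j$ is at most $D_{i,j}$. **Theorem.** For $\Delta=2$, TTR can be solved in time $4^{\mathrm{vc}}\cdot n^{O(1)}$, where $\mathrm{vc}$ is the vertex cover number of the input tree $G$. In particular, for $\Delta=2$, TTR can be solved in time $n^{O(1)}$ on instances in which $G$ is a star. Here, time is the number of steps of a random access machine with unit-cost operations on words of $O(\log(n+\max_{i,j}D_{i,j}))$ bits. -/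

import Mathlib

/-! ### Periodic temporal graphs -/

namespace Temporal

variable {V : Type*}

/-- A `Δ`-periodic labeling of `G`: every edge receives exactly one label from `{1, …, Δ}`. -/
abbrev PeriodicLabeling (G : SimpleGraph V) (Δ : ℕ) : Type _ :=
  G.edgeSet → Set.Icc 1 Δ

/-- The set `{lab e + i * Δ | i ≥ 0}` of times at which the edge `e` is available in the
`Δ`-periodic temporal graph `(G, lab, Δ)` (empty for non-edges). -/
def activeTimes {G : SimpleGraph V} {Δ : ℕ} (lab : PeriodicLabeling G Δ) (e : Sym2 V) : Set ℕ :=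
  {t | ∃ h : e ∈ G.edgeSet, ∃ i : ℕ, t = (lab ⟨e, h⟩ : ℕ) + i * Δ}

/-- A temporal path from `s` to `z`: a path of `G` together with one time for each of its edges,
in the order of traversal; each edge is available at its time, and times strictly increase. -/
structure TemporalPath {G : SimpleGraph V} {Δ : ℕ} (lab : PeriodicLabeling G Δ) (s z : V) where
  walk : G.Walk s z
  isPath : walk.IsPath
  times : List ℕ
  available : List.Forall₂ (fun e t => t ∈ activeTimes lab e) walk.edges times
  increasing : times.Pairwise (· < ·)

/-- Last time minus first time plus one; a path without edges has duration `0`. -/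
def TemporalPath.duration {G : SimpleGraph V} {Δ : ℕ} {lab : PeriodicLabeling G Δ} {s z : V}
    (P : TemporalPath lab s z) : ℕ :=
  match P.times with
  | [] => 0
  | t :: ts => (t :: ts).getLast (List.cons_ne_nil t ts) - t + 1

/-- A temporal path is fastest if its duration is minimum among all temporal paths with the same
end points. -/
def TemporalPath.IsFastest {G : SimpleGraph V} {Δ : ℕ} {lab : PeriodicLabeling G Δ} {s z : V}
    (P : TemporalPath lab s z) : Prop :=
  ∀ Q : TemporalPath lab s z, P.duration ≤ Q.duration

/-- The labeling realizes the upper bounds `D`: for all `u`, `v`, the duration of a fastest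
temporal path from `u` to `v` is at most `D u v`. -/
def Realizes {G : SimpleGraph V} {Δ : ℕ} (lab : PeriodicLabeling G Δ) (D : Matrix V V ℕ) : Prop :=
  ∀ u v : V, ∃ P : TemporalPath lab u v, P.IsFastest ∧ P.duration ≤ D u v

end Temporal

/-! ### The problem -/

/-- An instance of Periodic Upper-Bounded Temporal Tree Realization. -/
structure TTRInstance where
  /-- the number of vertices -/
  n : ℕ
  G : SimpleGraph (Fin n)
  isTree : G.IsTree
  D : Matrix (Fin n) (Fin n) ℕ
  D_pos : ∀ i j, 0 < D i j
  Δ : ℕ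
  Δ_pos : 0 < Δ

namespace TTRInstance

/-- `I` is a yes-instance. -/
def IsYes (I : TTRInstance) : Prop :=
  ∃ lab : Temporal.PeriodicLabeling I.G I.Δ, Temporal.Realizes lab I.D

/-- The vertex cover number of the input tree. -/
noncomputable def vc (I : TTRInstance) : ℕ := I.G.vertexCoverNum.toNat

/-- The input tree is a star: all edges share a common vertex. -/
def IsStar (I : TTRInstance) : Prop :=
  ∃ c : Fin I.n, ∀ u v : Fin I.n, I.G.Adj u v → u = c ∨ v = c

/-- The largest entry of `D`. -/
def maxD (I : TTRInstance) : ℕ :=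
  Finset.univ.sup fun p : Fin I.n × Fin I.n => I.D p.1 p.2

end TTRInstance

/-! ### Random access machines with unit cost and bounded words -/

namespace RAM

/-- Programs. Registers and arrays are named by numerals that are fixed in the program text, so a
program uses only finitely many of them; array cells are addressed through registers. -/
inductive Program : Type
  | skip : Program
  /-- `x := k` -/
  | const (x k : ℕ) : Program
  /-- `x := y` -/
  | copy (x y : ℕ) : Program
  /-- `x := y + z` -/
  | add (x y z : ℕ) : Program
  /-- `x := max (y - z) 0` -/
  | sub (x y z : ℕ) : Program
  /-- `x := y * z` -/
  | mul (x y z : ℕ) : Program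
  /-- `x := A[y]` -/
  | load (x A y : ℕ) : Program
  /-- `A[x] := y` -/
  | store (A x y : ℕ) : Program
  | seq (c d : Program) : Program
  /-- `if x ≠ 0 then c else d` -/
  | ite (x : ℕ) (c d : Program) : Program
  /-- `while x ≠ 0 do c` -/
  | loop (x : ℕ) (c : Program) : Program

/-- Contents of the registers and of the arrays. -/
@[ext]
structure State where
  reg : ℕ → ℕ
  arr : ℕ → ℕ → ℕ

/-- Write `v` into register `x`. -/
def State.setReg (s : State) (x v : ℕ) : State :=
  { s with reg := Function.update s.reg x v }

/-- Write `v` into cell `i` of array `A`. -/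
def State.setArr (s : State) (A i v : ℕ) : State :=
  { s with arr := Function.update s.arr A (Function.update (s.arr A) i v) }

/-- `Exec W c s t s'`: on a machine whose words hold the numbers `0, …, W`, the program `c` started
in state `s` halts after exactly `t` steps in state `s'`, and no operation overflows. Each elementary
operation and each evaluation of a test is one step. -/
inductive Exec (W : ℕ) : Program → State → ℕ → State → Prop
  | skip (s : State) : Exec W .skip s 1 s
  | const (x k : ℕ) (s : State) (h : k ≤ W) : Exec W (.const x k) s 1 (s.setReg x k)
  | copy (x y : ℕ) (s : State) : Exec W (.copy x y) s 1 (s.setReg x (s.reg y))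
  | add (x y z : ℕ) (s : State) (h : s.reg y + s.reg z ≤ W) :
      Exec W (.add x y z) s 1 (s.setReg x (s.reg y + s.reg z))
  | sub (x y z : ℕ) (s : State) : Exec W (.sub x y z) s 1 (s.setReg x (s.reg y - s.reg z))
  | mul (x y z : ℕ) (s : State) (h : s.reg y * s.reg z ≤ W) :
      Exec W (.mul x y z) s 1 (s.setReg x (s.reg y * s.reg z))
  | load (x A y : ℕ) (s : State) : Exec W (.load x A y) s 1 (s.setReg x (s.arr A (s.reg y)))
  | store (A x y : ℕ) (s : State) :
      Exec W (.store A x y) s 1 (s.setArr A (s.reg x) (s.reg y))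
  | seq {c d : Program} {s s₁ s₂ : State} {t₁ t₂ : ℕ}
      (h₁ : Exec W c s t₁ s₁) (h₂ : Exec W d s₁ t₂ s₂) :
      Exec W (.seq c d) s (t₁ + t₂) s₂
  | ite_true {x : ℕ} {c d : Program} {s s' : State} {t : ℕ}
      (hx : s.reg x ≠ 0) (h : Exec W c s t s') : Exec W (.ite x c d) s (1 + t) s'
  | ite_false {x : ℕ} {c d : Program} {s s' : State} {t : ℕ}
      (hx : s.reg x = 0) (h : Exec W d s t s') : Exec W (.ite x c d) s (1 + t) s'
  | loop_done {x : ℕ} {c : Program} {s : State} (hx : s.reg x = 0) : Exec W (.loop x c) s 1 s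
  | loop_step {x : ℕ} {c : Program} {s s₁ s₂ : State} {t₁ t₂ : ℕ}
      (hx : s.reg x ≠ 0) (h₁ : Exec W c s t₁ s₁) (h₂ : Exec W (.loop x c) s₁ t₂ s₂) :
      Exec W (.loop x c) s (1 + t₁ + t₂) s₂

/-- A square matrix as an array, row by row: entry `(i, j)` is in cell `i * n + j`. -/
def rowMajor {n : ℕ} (A : Matrix (Fin n) (Fin n) ℕ) (a : ℕ) : ℕ :=
  if h : a < n * n then A (Fin.divNat ⟨a, h⟩) (Fin.modNat ⟨a, h⟩) else 0

open scoped Classical in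
/-- The input: register `0` holds `n`, register `1` holds `Δ`, array `0` holds the adjacency matrix
of the tree, array `1` holds `D`, and everything else is `0`. -/
noncomputable def input (I : TTRInstance) : State where
  reg x := if x = 0 then I.n else if x = 1 then I.Δ else 0
  arr A := if A = 0 then rowMajor (I.G.adjMatrix ℕ) else if A = 1 then rowMajor I.D else 0

/-- On input `I`, with words holding the numbers `0, …, W`, the program halts after at most `T`
steps, with `1` in register `0` if `I` is a yes-instance and with `0` in register `0` otherwise. -/
def Decides (P : Program) (I : TTRInstance) (W T : ℕ) : Prop :=
  ∃ (t : ℕ) (s : State), Exec W P (input I) t s ∧ t ≤ T ∧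
    (I.IsYes → s.reg 0 = 1) ∧ (¬ I.IsYes → s.reg 0 = 0)

end RAM

/-!
For period two, going from one edge of a path to the next takes one unit of time if the labels of
the two edges differ and two units if they are equal. In a tree the path between two vertices is
unique, so the duration of a fastest temporal path is its number of edges plus the number of pairs
of consecutive edges with equal labels (`Temporal.realizes_iff`).

Root the tree, and name every edge by its lower end. All edges of a path except the first and the
last have a lower end that is not a leaf (`SimpleGraph.IsTree.lower_iterate`). Such *inner* vertices
either belong to a given vertex cover or have all their children in it, hence there are at most
`2 * vc` of them (`ncard_inner_le`), and at most one in a star (`ncard_inner_le_one`). Once the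
labels of the inner vertices are guessed, in at most `2 ^ (2 * vc) = 4 ^ vc` ways, every bound
`D s t` restricts two labels only, those of the first and of the last edge of the path. The question
becomes an instance of 2-satisfiability (`SimpleGraph.IsTree.consistent_iff`), which is decided by
the transitive closure of the implications between literals (`Relation.exists_assignment_iff`).

The algorithm is written in a small structured language whose only loops are counting loops. Its
commands are compiled to the machine with the expected effect (`RAM.Cmd.code_exec`) and in time
polynomial in a bound on the lengths of the loops (`RAM.Cmd.time_le`); they are verified with a
calculus of total correctness (`RAM.Cmd.Total`) in which a command comes with the list of the
registers and arrays that it may change. Everything but the enumeration of the guesses is such a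
command; the enumeration is one loop of the machine, controlled by the carry of a binary counter
(`RAM.search_exec`).
-/

/-! ### A structured language compiled to the machine -/

namespace RAM

/-- Arithmetic expressions over registers and array cells. -/
inductive Expr : Type
  | reg (r : ℕ) : Expr
  | num (k : ℕ) : Expr
  | add (a b : Expr) : Expr
  | sub (a b : Expr) : Expr
  | mul (a b : Expr) : Expr
  /-- the cell of array `A` whose index is the value of `e` -/
  | get (A : ℕ) (e : Expr) : Expr

namespace Expr

instance : Add Expr := ⟨add⟩
instance : Sub Expr := ⟨sub⟩
instance : Mul Expr := ⟨mul⟩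

/-- The value of an expression. -/
def eval : Expr → State → ℕ
  | reg r, s => s.reg r
  | num k, _ => k
  | add a b, s => a.eval s + b.eval s
  | sub a b, s => a.eval s - b.eval s
  | mul a b, s => a.eval s * b.eval s
  | get A e, s => s.arr A (e.eval s)

/-- No intermediate result of the evaluation exceeds `W`. -/
def Safe (W : ℕ) : Expr → State → Prop
  | reg _, _ => True
  | num k, _ => k ≤ W
  | add a b, s => a.Safe W s ∧ b.Safe W s ∧ a.eval s + b.eval s ≤ W
  | sub a b, s => a.Safe W s ∧ b.Safe W s
  | mul a b, s => a.Safe W s ∧ b.Safe W s ∧ a.eval s * b.eval s ≤ W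
  | get _ e, s => e.Safe W s

/-- Machine code that leaves the value in register `2 * d + 1`, using odd registers from there on
as scratch space. The language's register `r` is the machine's register `2 * r`. -/
def code : Expr → ℕ → Program
  | reg r, d => .copy (2 * d + 1) (2 * r)
  | num k, d => .const (2 * d + 1) k
  | add a b, d => .seq (a.code d) (.seq (b.code (d + 1)) (.add (2 * d + 1) (2 * d + 1) (2 * d + 3)))
  | sub a b, d => .seq (a.code d) (.seq (b.code (d + 1)) (.sub (2 * d + 1) (2 * d + 1) (2 * d + 3)))
  | mul a b, d => .seq (a.code d) (.seq (b.code (d + 1)) (.mul (2 * d + 1) (2 * d + 1) (2 * d + 3)))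
  | get A e, d => .seq (e.code d) (.load (2 * d + 1) A (2 * d + 1))

/-- The number of steps of the machine code. -/
def size : Expr → ℕ
  | reg _ => 1
  | num _ => 1
  | add a b => a.size + (b.size + 1)
  | sub a b => a.size + (b.size + 1)
  | mul a b => a.size + (b.size + 1)
  | get _ e => e.size + 1

section
variable (a b e : Expr) (s : State) (W r k A : ℕ)
@[simp] theorem eval_reg : (reg r).eval s = s.reg r := rfl
@[simp] theorem eval_num : (num k).eval s = k := rfl
@[simp] theorem eval_add : (a + b).eval s = a.eval s + b.eval s := rfl
@[simp] theorem eval_sub : (a - b).eval s = a.eval s - b.eval s := rfl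
@[simp] theorem eval_mul : (a * b).eval s = a.eval s * b.eval s := rfl
@[simp] theorem eval_get : (get A e).eval s = s.arr A (e.eval s) := rfl
@[simp] theorem safe_reg : (reg r).Safe W s ↔ True := Iff.rfl
@[simp] theorem safe_num : (num k).Safe W s ↔ k ≤ W := Iff.rfl
@[simp] theorem safe_add :
    (a + b).Safe W s ↔ a.Safe W s ∧ b.Safe W s ∧ a.eval s + b.eval s ≤ W := Iff.rfl
@[simp] theorem safe_sub : (a - b).Safe W s ↔ a.Safe W s ∧ b.Safe W s := Iff.rfl
@[simp] theorem safe_mul :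
    (a * b).Safe W s ↔ a.Safe W s ∧ b.Safe W s ∧ a.eval s * b.eval s ≤ W := Iff.rfl
@[simp] theorem safe_get : (get A e).Safe W s ↔ e.Safe W s := Iff.rfl
end

end Expr

namespace State

section
variable (s : State) (x y v A i : ℕ)
@[simp] theorem reg_setReg : (s.setReg x v).reg y = if y = x then v else s.reg y := by
  simp [setReg, Function.update_apply]
@[simp] theorem arr_setReg : (s.setReg x v).arr = s.arr := rfl
@[simp] theorem reg_setArr : (s.setArr A i v).reg = s.reg := rfl
theorem arr_setArr :
    (s.setArr A i v).arr = Function.update s.arr A (Function.update (s.arr A) i v) := rfl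
@[simp] theorem arr_setArr_self : (s.setArr A i v).arr A = Function.update (s.arr A) i v := by
  simp [arr_setArr]
@[simp] theorem arr_setArr_of_ne {B : ℕ} (h : B ≠ A) : (s.setArr A i v).arr B = s.arr B := by
  simp [arr_setArr, h]
end

/-- The part of the machine state that the structured language sees: the even registers. -/
def view (s : State) : State := ⟨fun r => s.reg (2 * r), s.arr⟩

@[simp] theorem view_reg (s : State) (r : ℕ) : s.view.reg r = s.reg (2 * r) := rfl
@[simp] theorem view_arr (s : State) : s.view.arr = s.arr := rfl

theorem view_setReg_even (s : State) (x v : ℕ) :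
    (s.setReg (2 * x) v).view = s.view.setReg x v := by
  ext r <;> simp

theorem view_setReg_odd (s : State) (x v : ℕ) : (s.setReg (2 * x + 1) v).view = s.view := by
  ext r
  · simp only [view_reg, reg_setReg]
    rw [if_neg (by omega)]
  · rfl

theorem view_setArr (s : State) (A i v : ℕ) : (s.setArr A i v).view = s.view.setArr A i v := rfl

end State

/-- The compiled expression computes the value; it spares the scratch registers that hold operands
evaluated earlier, and everything that the structured language sees. -/
theorem Expr.code_exec {W : ℕ} (e : Expr) : ∀ (d : ℕ) (s : State), e.Safe W s.view →
    ∃ s', Exec W (e.code d) s e.size s' ∧ s'.reg (2 * d + 1) = e.eval s.view ∧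
      (∀ i < d, s'.reg (2 * i + 1) = s.reg (2 * i + 1)) ∧ s'.view = s.view := by
  have binary {a b : Expr}
      (iha : ∀ (d : ℕ) (s : State), a.Safe W s.view →
        ∃ s', Exec W (a.code d) s a.size s' ∧ s'.reg (2 * d + 1) = a.eval s.view ∧
          (∀ i < d, s'.reg (2 * i + 1) = s.reg (2 * i + 1)) ∧ s'.view = s.view)
      (ihb : ∀ (d : ℕ) (s : State), b.Safe W s.view →
        ∃ s', Exec W (b.code d) s b.size s' ∧ s'.reg (2 * d + 1) = b.eval s.view ∧
          (∀ i < d, s'.reg (2 * i + 1) = s.reg (2 * i + 1)) ∧ s'.view = s.view)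
      (d : ℕ) (s : State) (ha : a.Safe W s.view) (hb : b.Safe W s.view) (op : Program) (v : ℕ)
      (hop : ∀ τ : State, τ.reg (2 * d + 1) = a.eval s.view → τ.reg (2 * d + 3) = b.eval s.view →
        Exec W op τ 1 (τ.setReg (2 * d + 1) v)) :
      ∃ s', Exec W (.seq (a.code d) (.seq (b.code (d + 1)) op)) s (a.size + (b.size + 1)) s' ∧
        s'.reg (2 * d + 1) = v ∧
        (∀ i < d, s'.reg (2 * i + 1) = s.reg (2 * i + 1)) ∧ s'.view = s.view := by
    obtain ⟨s₁, h₁, r₁, f₁, v₁⟩ := iha d s ha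
    obtain ⟨s₂, h₂, r₂, f₂, v₂⟩ := ihb (d + 1) s₁ (v₁ ▸ hb)
    refine ⟨_, .seq h₁ (.seq h₂ (hop s₂ (by rw [f₂ d (by omega), r₁]) (by rw [← v₁]; exact r₂))),
      by simp, fun i hi => ?_, by rw [State.view_setReg_odd, v₂, v₁]⟩
    rw [State.reg_setReg, if_neg (by omega), f₂ i (by omega), f₁ i hi]
  induction e with
  | reg r =>
    intro d s _
    refine ⟨_, .copy _ _ _, by simp [eval], fun i hi => ?_, State.view_setReg_odd _ _ _⟩
    rw [State.reg_setReg, if_neg (by omega)]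
  | num k =>
    intro d s h
    refine ⟨_, .const _ _ _ h, by simp [eval], fun i hi => ?_, State.view_setReg_odd _ _ _⟩
    rw [State.reg_setReg, if_neg (by omega)]
  | add a b iha ihb =>
    intro d s h
    exact binary iha ihb d s h.1 h.2.1 _ _ fun τ h₁ h₂ => by
      have := Exec.add (W := W) (2 * d + 1) (2 * d + 1) (2 * d + 3) τ (by rw [h₁, h₂]; exact h.2.2)
      rwa [h₁, h₂] at this
  | sub a b iha ihb =>
    intro d s h
    exact binary iha ihb d s h.1 h.2 _ _ fun τ h₁ h₂ => by
      have := Exec.sub (W := W) (2 * d + 1) (2 * d + 1) (2 * d + 3) τ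
      rwa [h₁, h₂] at this
  | mul a b iha ihb =>
    intro d s h
    exact binary iha ihb d s h.1 h.2.1 _ _ fun τ h₁ h₂ => by
      have := Exec.mul (W := W) (2 * d + 1) (2 * d + 1) (2 * d + 3) τ (by rw [h₁, h₂]; exact h.2.2)
      rwa [h₁, h₂] at this
  | get A e ih =>
    intro d s h
    obtain ⟨s₁, h₁, r₁, f₁, v₁⟩ := ih d s h
    refine ⟨_, .seq h₁ (.load _ _ _ _), ?_, fun i hi => ?_, by rw [State.view_setReg_odd, v₁]⟩
    · rw [State.reg_setReg, if_pos rfl, r₁, ← State.view_arr, v₁]; rfl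
    · rw [State.reg_setReg, if_neg (by omega), f₁ i hi]

/-- Structured commands. The only loop counts a register up to the value of another one, so every
command terminates. -/
inductive Cmd : Type
  | skip : Cmd
  /-- `x := e` -/
  | set (x : ℕ) (e : Expr) : Cmd
  /-- `A[i] := e` -/
  | put (A : ℕ) (i e : Expr) : Cmd
  | seq (c d : Cmd) : Cmd
  /-- `if e ≠ 0 then c else d` -/
  | ite (e : Expr) (c d : Cmd) : Cmd
  /-- `for x = 0, …, N - 1 do c` -/
  | rep (x N : ℕ) (c : Cmd) : Cmd

namespace Cmd

/-- The registers that a command writes. -/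
def regs : Cmd → List ℕ
  | skip => []
  | set x _ => [x]
  | put _ _ _ => []
  | seq c d => c.regs ++ d.regs
  | ite _ c d => c.regs ++ d.regs
  | rep x _ c => x :: c.regs

/-- The arrays that a command writes. -/
def arrs : Cmd → List ℕ
  | skip => []
  | set _ _ => []
  | put A _ _ => [A]
  | seq c d => c.arrs ++ d.arrs
  | ite _ c d => c.arrs ++ d.arrs
  | rep _ _ c => c.arrs

/-- The state before round `k` of a counting loop with counter `x` and body `f`. -/
def rounds (x : ℕ) (f : State → State) (s : State) : ℕ → State
  | 0 => s.setReg x 0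
  | k + 1 => (f (rounds x f s k)).setReg x (k + 1)

/-- The effect of a command. -/
def run : Cmd → State → State
  | skip, s => s
  | set x e, s => s.setReg x (e.eval s)
  | put A i e, s => s.setArr A (i.eval s) (e.eval s)
  | seq c d, s => d.run (c.run s)
  | ite e c d, s => if e.eval s ≠ 0 then c.run s else d.run s
  | rep x N c, s => rounds x c.run s (s.reg N)

/-- No expression evaluated during the run exceeds `W`, no loop has more than `B` rounds, and loop
bodies leave the counter and the bound of the loop alone. -/
def Safe (W B : ℕ) : Cmd → State → Prop
  | skip, _ => True
  | set _ e, s => e.Safe W s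
  | put _ i e, s => i.Safe W s ∧ e.Safe W s
  | seq c d, s => c.Safe W B s ∧ d.Safe W B (c.run s)
  | ite e c d, s => e.Safe W s ∧ (e.eval s ≠ 0 → c.Safe W B s) ∧ (e.eval s = 0 → d.Safe W B s)
  | rep x N c, s => x ≠ N ∧ x ∉ c.regs ∧ N ∉ c.regs ∧ s.reg N ≤ W ∧ s.reg N ≤ B ∧
      ∀ k < s.reg N, c.Safe W B (rounds x c.run s k)

/-- The machine code of a command. -/
def code : Cmd → Program
  | skip => .skip
  | set x e => .seq (e.code 0) (.copy (2 * x) 1)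
  | put A i e => .seq (i.code 0) (.seq (e.code 1) (.store A 1 3))
  | seq c d => .seq c.code d.code
  | ite e c d => .seq (e.code 0) (.ite 1 c.code d.code)
  | rep x N c => .seq (.const (2 * x) 0) (.seq (.sub 1 (2 * N) (2 * x))
      (.loop 1 (.seq c.code
        (.seq (.const 1 1) (.seq (.add (2 * x) (2 * x) 1) (.sub 1 (2 * N) (2 * x)))))))

/-- A bound for the number of steps when no loop has more than `B` rounds. -/
def time (B : ℕ) : Cmd → ℕ
  | skip => 1
  | set _ e => e.size + 1
  | put _ i e => i.size + (e.size + 1)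
  | seq c d => c.time B + d.time B
  | ite e c d => e.size + (1 + (c.time B + d.time B))
  | rep _ _ c => 3 + B * (c.time B + 4)

/-- The nesting depth of loops. -/
def depth : Cmd → ℕ
  | skip => 0
  | set _ _ => 0
  | put _ _ _ => 0
  | seq c d => max c.depth d.depth
  | ite _ c d => max c.depth d.depth
  | rep _ _ c => c.depth + 1

/-- Running times are polynomial in the bound on loop lengths. -/
theorem time_le {B : ℕ} (hB : 0 < B) (c : Cmd) : c.time B ≤ c.time 1 * B ^ c.depth := by
  have two {t₁ t₂ u₁ u₂ a b : ℕ} (h₁ : t₁ ≤ u₁ * B ^ a) (h₂ : t₂ ≤ u₂ * B ^ b) :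
      t₁ + t₂ ≤ (u₁ + u₂) * B ^ max a b := by
    rw [add_mul]
    exact add_le_add (h₁.trans (Nat.mul_le_mul_left _ (Nat.pow_le_pow_right hB (le_max_left _ _))))
      (h₂.trans (Nat.mul_le_mul_left _ (Nat.pow_le_pow_right hB (le_max_right _ _))))
  induction c with
  | skip => simp [time, depth]
  | set x e => simp [time, depth]
  | put A i e => simp [time, depth]
  | seq c d ihc ihd => exact two ihc ihd
  | ite e c d ihc ihd =>
    have h := two ihc ihd
    have : 1 ≤ B ^ max c.depth d.depth := Nat.one_le_pow _ _ hB
    simp only [time, depth]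
    nlinarith [Nat.mul_le_mul_left (e.size + 1) this]
  | rep x N c ih =>
    have : 1 ≤ B ^ c.depth := Nat.one_le_pow _ _ hB
    have h1 : 1 ≤ B ^ (c.depth + 1) := Nat.one_le_pow _ _ hB
    simp only [time, depth]
    calc 3 + B * (c.time B + 4) ≤ 3 * B ^ (c.depth + 1) +
          B * (c.time 1 * B ^ c.depth + 4 * B ^ c.depth) := by gcongr <;> omega
      _ = _ := by ring

/-- Outside the given registers and arrays the two states agree. -/
structure Frame (R A : List ℕ) (s s' : State) : Prop where
  reg : ∀ r, r ∉ R → s'.reg r = s.reg r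
  arr : ∀ a, a ∉ A → s'.arr a = s.arr a

theorem Frame.refl (R A : List ℕ) (s : State) : Frame R A s s := ⟨fun _ _ => rfl, fun _ _ => rfl⟩

theorem Frame.trans {R A : List ℕ} {s₁ s₂ s₃ : State} (h : Frame R A s₁ s₂) (h' : Frame R A s₂ s₃) :
    Frame R A s₁ s₃ :=
  ⟨fun r hr => (h'.reg r hr).trans (h.reg r hr), fun a ha => (h'.arr a ha).trans (h.arr a ha)⟩

theorem Frame.mono {R A R' A' : List ℕ} {s s' : State} (h : Frame R A s s') (hR : R ⊆ R')
    (hA : A ⊆ A') : Frame R' A' s s' :=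
  ⟨fun r hr => h.reg r fun h => hr (hR h), fun a ha => h.arr a fun h => ha (hA h)⟩

theorem frame_setReg (x v : ℕ) (s : State) : Frame [x] [] s (s.setReg x v) :=
  ⟨fun r hr => by simp_all, fun _ _ => rfl⟩

theorem frame_rounds {x : ℕ} {f : State → State} {R A : List ℕ}
    (hf : ∀ s, Frame R A s (f s)) (s : State) (k : ℕ) :
    Frame (x :: R) A s (rounds x f s k) := by
  induction k with
  | zero => exact (frame_setReg x 0 s).mono (by simp) (by simp)
  | succ k ih =>
    exact ih.trans (((hf _).mono (by simp) (by simp)).trans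
      ((frame_setReg x _ _).mono (by simp) (by simp)))

theorem frame_run (c : Cmd) : ∀ s, Frame c.regs c.arrs s (c.run s) := by
  induction c with
  | skip => exact fun s => .refl _ _ _
  | set x e => exact fun s => frame_setReg _ _ _
  | put A i e =>
    refine fun s => ⟨fun _ _ => rfl, fun a ha => ?_⟩
    exact State.arr_setArr_of_ne _ _ _ _ (by simpa [arrs] using ha)
  | seq c d ihc ihd =>
    exact fun s => ((ihc s).mono (by simp [regs]) (by simp [arrs])).trans
      ((ihd _).mono (by simp [regs]) (by simp [arrs]))
  | ite e c d ihc ihd =>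
    intro s
    simp only [run]
    split
    · exact (ihc s).mono (by simp [regs]) (by simp [arrs])
    · exact (ihd s).mono (by simp [regs]) (by simp [arrs])
  | rep x N c ih => exact fun s => frame_rounds ih s _

theorem reg_rounds_self (x : ℕ) (f : State → State) (s : State) (k : ℕ) :
    (rounds x f s k).reg x = k := by
  cases k <;> simp [rounds]

/-- The compiled code does what the command says. -/
theorem code_exec {W B : ℕ} (c : Cmd) : ∀ s : State, c.Safe W B s.view →
    ∃ t s', Exec W c.code s t s' ∧ t ≤ c.time B ∧ s'.view = c.run s.view := by
  induction c with
  | skip => exact fun s _ => ⟨_, _, .skip s, le_rfl, rfl⟩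
  | set x e =>
    intro s h
    obtain ⟨s₁, h₁, r₁, -, v₁⟩ := e.code_exec 0 s h
    refine ⟨_, _, .seq h₁ (.copy _ _ _), le_rfl, ?_⟩
    rw [State.view_setReg_even, v₁]
    exact congrArg _ r₁
  | put A i e =>
    intro s h
    obtain ⟨s₁, h₁, r₁, -, v₁⟩ := i.code_exec 0 s h.1
    obtain ⟨s₂, h₂, r₂, f₂, v₂⟩ := e.code_exec 1 s₁ (v₁ ▸ h.2)
    refine ⟨_, _, .seq h₁ (.seq h₂ (.store _ _ _ _)), le_rfl, ?_⟩
    rw [State.view_setArr, v₂, v₁]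
    have := f₂ 0 (by omega)
    simp only [mul_zero, zero_add, mul_one] at this r₁ r₂
    simp only [this, r₁, r₂, v₁, run]
  | seq c d ihc ihd =>
    intro s h
    obtain ⟨t₁, s₁, h₁, l₁, v₁⟩ := ihc s h.1
    obtain ⟨t₂, s₂, h₂, l₂, v₂⟩ := ihd s₁ (v₁ ▸ h.2)
    exact ⟨_, _, .seq h₁ h₂, add_le_add l₁ l₂, by rw [v₂, v₁]; rfl⟩
  | ite e c d ihc ihd =>
    intro s h
    obtain ⟨s₁, h₁, r₁, -, v₁⟩ := e.code_exec 0 s h.1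
    by_cases he : e.eval s.view = 0
    · obtain ⟨t₂, s₂, h₂, l₂, v₂⟩ := ihd s₁ (v₁ ▸ h.2.2 he)
      refine ⟨_, _, .seq h₁ (.ite_false (r₁.trans he) h₂), by simp only [time]; omega, ?_⟩
      simp [run, he, v₂, v₁]
    · obtain ⟨t₂, s₂, h₂, l₂, v₂⟩ := ihc s₁ (v₁ ▸ h.2.1 he)
      refine ⟨_, _, .seq h₁ (.ite_true (fun h => he (r₁.symm.trans h)) h₂),
        by simp only [time]; omega, ?_⟩
      simp [run, he, v₂, v₁]
  | rep x N c ih =>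
    intro s ⟨hxN, hx, hN, hW, hB, h⟩
    set σ := s.view with hσ
    set n := σ.reg N
    set L : Program := .loop 1 (.seq c.code
        (.seq (.const 1 1) (.seq (.add (2 * x) (2 * x) 1) (.sub 1 (2 * N) (2 * x))))) with hL
    have hfr (k : ℕ) : (rounds x c.run σ k).reg N = n :=
      (frame_rounds (frame_run c) σ k).reg N (by simp [hN, Ne.symm hxN])
    have key : ∀ m k, m + k = n → ∀ τ : State, τ.view = rounds x c.run σ k → τ.reg 1 = m →
        ∃ t τ', Exec W L τ t τ' ∧ t ≤ m * (c.time B + 4) + 1 ∧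
          τ'.view = rounds x c.run σ n := by
      intro m
      induction m with
      | zero =>
        intro k hk τ hτ h1
        exact ⟨1, τ, .loop_done h1, by omega, by rw [hτ]; congr; omega⟩
      | succ m ihm =>
        intro k hk τ hτ h1
        obtain ⟨t₁, s₁, h₁, l₁, v₁⟩ := ih τ (hτ ▸ h k (by omega))
        have hx1 : s₁.reg (2 * x) = k := by
          rw [← State.view_reg, v₁, (frame_run c _).reg x hx, hτ, reg_rounds_self]
        have hN1 : s₁.reg (2 * N) = n := by
          rw [← State.view_reg, v₁, (frame_run c _).reg N hN, hτ, hfr]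
        have hxN' : 2 * N ≠ 2 * x := by omega
        have hstep : Exec W (.seq (.const 1 1) (.seq (.add (2 * x) (2 * x) 1)
            (.sub 1 (2 * N) (2 * x)))) s₁ (1 + (1 + 1))
            (((s₁.setReg 1 1).setReg (2 * x) (k + 1)).setReg 1 m) := by
          refine .seq (.const _ _ _ (by omega))
            (.seq (s₁ := (s₁.setReg 1 1).setReg (2 * x) (k + 1)) ?_ ?_)
          · have hne : 2 * x ≠ 1 := by omega
            have := Exec.add (W := W) (2 * x) (2 * x) 1 (s₁.setReg 1 1)
              (by simp [hne, hx1]; omega)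
            simpa [hne, hx1] using this
          · have hne : 2 * N ≠ 1 := by omega
            have := Exec.sub (W := W) 1 (2 * N) (2 * x) ((s₁.setReg 1 1).setReg (2 * x) (k + 1))
            have hm : n - (k + 1) = m := by omega
            simpa [hne, Ne.symm hxN, hN1, hm] using this
        obtain ⟨t₂, s₂, h₂, l₂, v₂⟩ := ihm (k + 1) (by omega)
          (((s₁.setReg 1 1).setReg (2 * x) (k + 1)).setReg 1 m) (by
            rw [State.view_setReg_odd _ 0, State.view_setReg_even, State.view_setReg_odd _ 0, v₁,
              hτ]
            rfl) (by simp)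
        refine ⟨_, _, .loop_step (by omega) (.seq h₁ hstep) h₂, ?_, v₂⟩
        rw [add_mul]
        omega
    obtain ⟨t, s', he, hl, hv⟩ := key n 0 (by omega)
      (((s.setReg (2 * x) 0)).setReg 1 n)
      (by rw [State.view_setReg_odd _ 0, State.view_setReg_even]; rfl) (by simp)
    refine ⟨1 + (1 + t), s', .seq (.const _ _ _ (by omega)) (.seq ?_ he), ?_, hv⟩
    · have := Exec.sub (W := W) 1 (2 * N) (2 * x) (s.setReg (2 * x) 0)
      have hxN' : ¬ N = x := fun h => hxN h.symm
      simpa [hxN', hσ, n] using this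
    · simp only [time]
      nlinarith [Nat.mul_le_mul_right (c.time B + 4) hB]

/-- Total correctness: from `s` the command runs safely and ends in a state satisfying `Q`. -/
def Total (W B : ℕ) (c : Cmd) (s : State) (Q : State → Prop) : Prop :=
  c.Safe W B s ∧ Q (c.run s)

section
variable {W B : ℕ} {c d : Cmd} {s : State} {Q Q' : State → Prop}

theorem Total.imp (h : c.Total W B s Q) (hQ : ∀ s', Q s' → Q' s') : c.Total W B s Q' :=
  ⟨h.1, hQ _ h.2⟩

/-- The consequence rule, with the frame available. -/
theorem Total.imp_frame (h : c.Total W B s Q)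
    (hQ : ∀ s', Frame c.regs c.arrs s s' → Q s' → Q' s') : c.Total W B s Q' :=
  ⟨h.1, hQ _ (frame_run c s) h.2⟩

@[simp] theorem total_skip : skip.Total W B s Q ↔ Q s := by simp [Total, Safe, run]

@[simp] theorem total_set {x : ℕ} {e : Expr} :
    (set x e).Total W B s Q ↔ e.Safe W s ∧ Q (s.setReg x (e.eval s)) := Iff.rfl

@[simp] theorem total_put {A : ℕ} {i e : Expr} :
    (put A i e).Total W B s Q ↔
      i.Safe W s ∧ e.Safe W s ∧ Q (s.setArr A (i.eval s) (e.eval s)) := and_assoc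

theorem total_seq : (seq c d).Total W B s Q ↔ c.Total W B s fun s' => d.Total W B s' Q := and_assoc

@[simp] theorem total_ite {e : Expr} :
    (ite e c d).Total W B s Q ↔
      e.Safe W s ∧ (e.eval s ≠ 0 → c.Total W B s Q) ∧ (e.eval s = 0 → d.Total W B s Q) := by
  by_cases h : e.eval s = 0 <;> simp [Total, Safe, run, h, and_assoc]

/-- The invariant rule for counting loops. `I k` is asserted before round `k`. -/
theorem Total.rep {x N : ℕ} (I : ℕ → State → Prop) (hxN : x ≠ N) (hx : x ∉ c.regs) (hN : N ∉ c.regs)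
    (hW : s.reg N ≤ W) (hB : s.reg N ≤ B) (h0 : I 0 (s.setReg x 0))
    (hstep : ∀ k < s.reg N, ∀ τ, Frame (x :: c.regs) c.arrs s τ → τ.reg x = k → I k τ →
      c.Total W B τ fun τ' => I (k + 1) (τ'.setReg x (k + 1)))
    (hQ : ∀ τ, Frame (x :: c.regs) c.arrs s τ → I (s.reg N) τ → Q τ) :
    (rep x N c).Total W B s Q := by
  have hI : ∀ k ≤ s.reg N, I k (rounds x c.run s k) := by
    intro k
    induction k with
    | zero => exact fun _ => h0
    | succ k ih =>
      exact fun hk => (hstep k hk _ (frame_rounds (frame_run c) s k) (reg_rounds_self _ _ _ _)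
        (ih (by omega))).2
  refine ⟨⟨hxN, hx, hN, hW, hB, fun k hk => ?_⟩,
    hQ _ (frame_rounds (frame_run c) s _) (hI _ le_rfl)⟩
  exact (hstep k hk _ (frame_rounds (frame_run c) s k) (reg_rounds_self _ _ _ _)
    (hI k hk.le)).1

/-- The invariant rule for a loop over `Fin n`. -/
theorem Total.rep_fin {x N n : ℕ} (I : ℕ → State → Prop) (hN : s.reg N = n) (hW : n ≤ W)
    (hB : n ≤ B) (h0 : I 0 (s.setReg x 0))
    (hstep : ∀ (k : Fin n) (τ : State), Frame (x :: c.regs) c.arrs s τ → τ.reg x = k → I k τ →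
      c.Total W B τ fun τ' => I (k + 1) (τ'.setReg x (k + 1)))
    (hQ : ∀ τ, Frame (x :: c.regs) c.arrs s τ → I n τ → Q τ)
    (hx : x ≠ N ∧ x ∉ c.regs ∧ N ∉ c.regs := by decide) :
    (Cmd.rep x N c).Total W B s Q := by
  subst hN
  exact .rep I hx.1 hx.2.1 hx.2.2 hW hB h0 (fun k hk => hstep ⟨k, hk⟩) hQ

/-- The rule for a loop over `Fin n` whose rounds establish independent properties `P k` of the
arrays, while `J` holds throughout. -/
theorem Total.rep_forall {x N n : ℕ} (J : (ℕ → ℕ → ℕ) → Prop) (P : Fin n → (ℕ → ℕ → ℕ) → Prop)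
    (hN : s.reg N = n) (hW : n ≤ W) (hB : n ≤ B) (h0 : J s.arr)
    (hstep : ∀ (k : Fin n) (τ : State), Frame (x :: c.regs) c.arrs s τ → τ.reg x = k → J τ.arr →
      c.Total W B τ fun τ' =>
        J τ'.arr ∧ P k τ'.arr ∧ ∀ l, l ≠ k → P l τ.arr → P l τ'.arr)
    (hx : x ≠ N ∧ x ∉ c.regs ∧ N ∉ c.regs := by decide) :
    (Cmd.rep x N c).Total W B s fun τ => J τ.arr ∧ ∀ k, P k τ.arr := by
  refine .rep_fin (fun k τ => J τ.arr ∧ ∀ l : Fin n, l < k → P l τ.arr)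
    hN hW hB ⟨h0, by simp⟩ (fun k τ hf hk ⟨hJ, hP⟩ => ?_)
    (fun τ _ ⟨hJ, hP⟩ => ⟨hJ, fun k => hP k k.2⟩) hx
  refine (hstep k τ hf hk hJ).imp fun τ' ⟨hJ', h₁, h₂⟩ => ⟨hJ', fun l hl => ?_⟩
  by_cases h : l = k
  · exact h ▸ h₁
  · exact h₂ l h (hP l (by have := Fin.val_ne_of_ne h; omega))

/-- The rule for a loop over `Fin n` whose rounds enlarge a relation `P` on the arrays independently
of each other, while `J` holds throughout. -/
theorem Total.rep_acc {α : Type*} {x N n : ℕ} (J : (ℕ → ℕ → ℕ) → Prop)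
    (P : (ℕ → ℕ → ℕ) → α → Prop) (R : Fin n → α → Prop) (hN : s.reg N = n) (hW : n ≤ W)
    (hB : n ≤ B) (h0 : J s.arr)
    (hstep : ∀ (k : Fin n) (τ : State), Frame (x :: c.regs) c.arrs s τ → τ.reg x = k → J τ.arr →
      c.Total W B τ fun τ' => J τ'.arr ∧ ∀ a, P τ'.arr a ↔ P τ.arr a ∨ R k a)
    (hx : x ≠ N ∧ x ∉ c.regs ∧ N ∉ c.regs := by decide) :
    (Cmd.rep x N c).Total W B s fun τ =>
      J τ.arr ∧ ∀ a, P τ.arr a ↔ P s.arr a ∨ ∃ k, R k a := by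
  refine .rep_fin (fun k τ => J τ.arr ∧ ∀ a, P τ.arr a ↔ P s.arr a ∨ ∃ l : Fin n, l < k ∧ R l a)
    hN hW hB ⟨h0, by simp⟩ (fun k τ hf hk ⟨hJ, hP⟩ => ?_) (fun τ _ ⟨hJ, hP⟩ => ⟨hJ, ?_⟩) hx
  · refine (hstep k τ hf hk hJ).imp fun τ' ⟨hJ', hP'⟩ => ⟨hJ', fun a => ?_⟩
    rw [State.arr_setReg, hP' a, hP a, or_assoc]
    refine or_congr_right ⟨?_, ?_⟩
    · rintro (⟨l, hl, h⟩ | h)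
      · exact ⟨l, by omega, h⟩
      · exact ⟨k, by omega, h⟩
    · rintro ⟨l, hl, h⟩
      rcases Nat.lt_succ_iff_lt_or_eq.1 hl with hl | hl
      · exact .inl ⟨l, hl, h⟩
      · exact .inr (Fin.ext hl ▸ h)
  · simpa using hP

end

end Cmd

end RAM

/-! ### Next hops in a tree -/

namespace SimpleGraph.IsTree

variable {V : Type*} {G : SimpleGraph V}

/-- The neighbor of `x` on the path from `x` to `t`; it is `t` itself if `x = t`. -/
noncomputable def next (hG : G.IsTree) (t x : V) : V :=
  (hG.existsUnique_path x t).choose.snd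

variable (hG : G.IsTree)
include hG

theorem next_eq_snd {t x : V} {p : G.Walk x t} (hp : p.IsPath) : hG.next t x = p.snd := by
  have h := (hG.existsUnique_path x t).choose_spec
  rw [next, h.2 p hp]

theorem next_self (t : V) : hG.next t t = t :=
  hG.next_eq_snd (p := .nil) .nil

theorem next_eq_of_dist {t x y : V} (h : G.Adj x y) (hd : G.dist x t = G.dist y t + 1) :
    hG.next t x = y := by
  obtain ⟨q, hq⟩ := hG.connected.exists_walk_length_eq_dist y t
  have hp : (Walk.cons h q).IsPath :=
    Walk.isPath_of_length_eq_dist _ (by rw [Walk.length_cons, hq, hd])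
  simpa using hG.next_eq_snd hp

theorem next_of_adj {t x : V} (h : G.Adj x t) : hG.next t x = t :=
  hG.next_eq_of_dist h (by rw [dist_eq_one_iff_adj.2 h, dist_self])

theorem dist_step {t x y : V} (h : G.Adj x y) :
    G.dist x t = G.dist y t + 1 ∨ G.dist y t = G.dist x t + 1 := by
  simpa only [dist_comm (v := t)] using hG.dist_eq_dist_add_one_of_adj t h

/-- Every edge is crossed in one of its directions on the way to `t`. -/
theorem next_eq_or_next_eq (t : V) {x y : V} (h : G.Adj x y) :
    hG.next t x = y ∨ hG.next t y = x :=
  (hG.dist_step h).imp (hG.next_eq_of_dist h) (hG.next_eq_of_dist h.symm)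

theorem adj_next {t x : V} (h : x ≠ t) : G.Adj x (hG.next t x) := by
  obtain ⟨p, hp, -⟩ := hG.existsUnique_path x t
  rw [hG.next_eq_snd hp]
  exact p.adj_snd (Walk.not_nil_of_ne h)

theorem dist_next {t x : V} (h : x ≠ t) : G.dist x t = G.dist (hG.next t x) t + 1 := by
  obtain ⟨p, hp⟩ := hG.connected.exists_walk_length_eq_dist x t
  have hs := hG.next_eq_snd (Walk.isPath_of_length_eq_dist p hp)
  refine (hG.dist_step (hG.adj_next h)).resolve_right fun h' => ?_
  cases p with
  | nil => exact h rfl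
  | cons e q =>
    have : G.dist (hG.next t x) t ≤ q.length := by
      rw [hs]; simpa using dist_le q
    rw [Walk.length_cons] at hp
    omega

theorem next_ne {t x : V} (h : x ≠ t) : hG.next t x ≠ x := (hG.adj_next h).ne'

theorem next_next_ne {t x : V} (h : hG.next t x ≠ t) : hG.next t (hG.next t x) ≠ x := by
  have hx : x ≠ t := fun e => h (e ▸ hG.next_self t)
  intro e
  have h₁ := hG.dist_next hx
  have h₂ := hG.dist_next h
  rw [e] at h₂
  omega

/-- Going towards `t` from `s` and looking back towards `s` one sees the previous vertex. -/
theorem next_iterate_succ (s t : V) (i : ℕ) (h : (hG.next t)^[i] s ≠ t) :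
    hG.next s ((hG.next t)^[i + 1] s) = (hG.next t)^[i] s := by
  induction i with
  | zero =>
    simp only [Function.iterate_zero, id, Function.iterate_succ] at h ⊢
    refine (hG.next_eq_or_next_eq s (hG.adj_next h)).resolve_left ?_
    rw [hG.next_self]
    exact (hG.next_ne h).symm
  | succ i ih =>
    rw [Function.iterate_succ_apply' _ (i + 1)]
    refine (hG.next_eq_or_next_eq s (hG.adj_next h)).resolve_left ?_
    have hi : hG.next t ((hG.next t)^[i] s) ≠ t := by
      rwa [← Function.iterate_succ_apply' (hG.next t)]
    rw [ih fun e => hi (by rw [e, hG.next_self]), Function.iterate_succ_apply' _ i]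
    exact (hG.next_next_ne hi).symm

open scoped Classical in
/-- In the tree rooted at `r`, the lower end of the edge that leads from `x` towards `t`. Edges of
the tree are named by their lower ends. -/
noncomputable def lower (r t x : V) : V :=
  if hG.next r x = hG.next t x then x else hG.next t x

theorem lower_spec {r t x : V} (h : x ≠ t) :
    hG.lower r t x ≠ r ∧
      s(hG.lower r t x, hG.next r (hG.lower r t x)) = s(x, hG.next t x) := by
  have hadj := hG.adj_next h
  unfold lower
  split_ifs with hx
  · refine ⟨?_, by rw [hx]⟩
    rintro rfl
    exact hadj.ne ((hG.next_self x).symm.trans hx)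
  · have := (hG.next_eq_or_next_eq r hadj).resolve_left hx
    refine ⟨fun e => hadj.ne ?_, by rw [this, Sym2.eq_swap]⟩
    rw [e, hG.next_self] at this
    exact this.symm.trans e.symm

/-- An edge determines its lower end. -/
theorem eq_of_edge_eq {r c d : V} (hc : c ≠ r) (hd : d ≠ r)
    (h : s(c, hG.next r c) = s(d, hG.next r d)) : c = d := by
  rcases Sym2.eq_iff.1 h with ⟨h, -⟩ | ⟨h₁, h₂⟩
  · exact h
  · have := hG.dist_next hc
    have := hG.dist_next hd
    rw [← h₁] at this
    rw [h₂] at *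
    omega

theorem exists_lower (r : V) {e : Sym2 V} (he : e ∈ G.edgeSet) :
    ∃ c, c ≠ r ∧ e = s(c, hG.next r c) := by
  induction e with
  | _ x y =>
    have h := hG.lower_spec (t := y) (r := r) (G.ne_of_adj he)
    rw [hG.next_of_adj he] at h
    exact ⟨_, h.1, h.2.symm⟩

/-- The non-root vertices that have a child in the tree rooted at `r`. -/
def inner (r : V) : Set V := {v | v ≠ r ∧ ∃ w, hG.next r w = v}

/-- Every edge of the path from `s` to `t` is the first one, the last one, or one whose lower end
is not a leaf. -/
theorem lower_iterate (r s t : V) (i : ℕ) (h : (hG.next t)^[i] s ≠ t) :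
    hG.lower r t ((hG.next t)^[i] s) = hG.lower r t s ∨
      hG.lower r t ((hG.next t)^[i] s) = hG.lower r s t ∨
        hG.lower r t ((hG.next t)^[i] s) ∈ hG.inner r := by
  cases i with
  | zero => exact .inl rfl
  | succ i =>
    right
    set w := (hG.next t)^[i] s with hw
    have hwx : (hG.next t)^[i + 1] s = hG.next t w := Function.iterate_succ_apply' _ _ _
    set x := (hG.next t)^[i + 1] s with hx
    by_cases hy : hG.next t x = t
    · left
      have hback := hG.next_iterate_succ s t (i + 1) h
      rw [Function.iterate_succ_apply' _ (i + 1), ← hx, hy] at hback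
      have h₁ := hG.lower_spec (r := r) h
      have hs : t ≠ s := by
        rintro rfl
        exact h (Function.iterate_fixed (hG.next_self t) _)
      have h₂ := hG.lower_spec (r := r) hs
      refine hG.eq_of_edge_eq h₁.1 h₂.1 ?_
      rw [h₁.2, h₂.2, hy, hback, Sym2.eq_swap]
    · right
      refine ⟨(hG.lower_spec h).1, ?_⟩
      have hwt : w ≠ t := fun e => h (by rw [hwx, e, hG.next_self])
      unfold lower
      split_ifs with hp
      · refine ⟨w, ((hG.next_eq_or_next_eq r (hG.adj_next hwt)).resolve_right ?_).trans hwx.symm⟩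
        rw [← hwx, hp, hwx]
        exact hG.next_next_ne (hwx ▸ h)
      · refine ⟨hG.next t (hG.next t x),
          (hG.next_eq_or_next_eq r (hG.adj_next hy)).resolve_left ?_⟩
        rw [(hG.next_eq_or_next_eq r (hG.adj_next h)).resolve_left hp]
        exact (hG.next_next_ne hy).symm

/-- A vertex cover contains every inner vertex or else all its children. -/
theorem ncard_inner_le [Finite V] (r : V) : (hG.inner r).ncard ≤ 2 * G.vertexCoverNum.toNat := by
  obtain ⟨S, hS, hc⟩ := G.vertexCoverNum_exists
  classical
  have hSn : G.vertexCoverNum.toNat = S.ncard := by rw [← hS]; rfl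
  choose! w hw using fun (v : V) (hv : v ∈ hG.inner r) => hv.2
  have hsub : hG.inner r ⊆ S ∪ hG.next r '' S := by
    intro v hv
    by_cases h : v ∈ S
    · exact .inl h
    · refine .inr ⟨w v, ?_, hw v hv⟩
      have hne : w v ≠ r := fun e => hv.1 (by rw [← hw v hv, e, hG.next_self])
      have := hG.adj_next hne
      rw [hw v hv] at this
      exact (hc this).resolve_right h
  calc (hG.inner r).ncard ≤ (S ∪ hG.next r '' S).ncard := Set.ncard_le_ncard hsub
    _ ≤ S.ncard + (hG.next r '' S).ncard := Set.ncard_union_le _ _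
    _ ≤ 2 * G.vertexCoverNum.toNat := by
      have := Set.ncard_image_le (f := hG.next r) S.toFinite
      omega

/-- In a star only the center can be an inner vertex: the parent and a child of another vertex would
both be the center. -/
theorem ncard_inner_le_one (r : V) {c : V} (hc : ∀ u v, G.Adj u v → u = c ∨ v = c) :
    (hG.inner r).ncard ≤ 1 := by
  have : hG.inner r ⊆ {c} := by
    rintro v ⟨hv, w, rfl⟩
    by_contra hne
    have hw : w ≠ r := fun e => hv (by rw [e, hG.next_self])
    have h₁ := (hc _ _ (hG.adj_next hw)).resolve_right hne
    have h₂ := (hc _ _ (hG.adj_next hv)).resolve_left hne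
    exact hG.next_next_ne hv (h₂.trans h₁.symm)
  simpa using Set.ncard_le_ncard this

end SimpleGraph.IsTree

/-! ### Durations of temporal paths with period two -/

namespace Temporal

/-- The least duration of a walk whose edges carry the given labels, for period two: passing from
one edge to the next takes one unit of time if the labels differ and two if they are equal. -/
def stretch {α : Type*} [DecidableEq α] : List α → ℕ
  | [] => 0
  | [_] => 1
  | a :: b :: l => (if a = b then 2 else 1) + stretch (b :: l)

variable {V : Type*} {G : SimpleGraph V}

open scoped Classical in
/-- The label of an edge as an element of `Fin 2`: label `1` is `0` and label `2` is `1`. -/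
noncomputable def colour (lab : PeriodicLabeling G 2) (e : Sym2 V) : Fin 2 :=
  if h : e ∈ G.edgeSet then ⟨(lab ⟨e, h⟩ : ℕ) - 1, by have := (lab ⟨e, h⟩).2.2; omega⟩ else 0

theorem mem_activeTimes {lab : PeriodicLabeling G 2} {e : Sym2 V} (he : e ∈ G.edgeSet) (t : ℕ) :
    t ∈ activeTimes lab e ↔ 0 < t ∧ t % 2 = (colour lab e + 1) % 2 := by
  have h := (lab ⟨e, he⟩).2
  rw [Set.mem_Icc] at h
  simp only [activeTimes, Set.mem_ofPred_eq, he, exists_true_left, colour, dif_pos]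
  refine ⟨?_, fun ht => ⟨(t - lab ⟨e, he⟩) / 2, by omega⟩⟩
  rintro ⟨i, rfl⟩
  omega

/-- No choice of times is faster: available times have the parity prescribed by the label, so that
consecutive times differ by at least two if the labels are equal. -/
theorem stretch_le_of_forall₂ {lab : PeriodicLabeling G 2} (es : List (Sym2 V)) :
    ∀ (e : Sym2 V) (t : ℕ) (ts : List ℕ),
      List.Forall₂ (fun e t => t ∈ activeTimes lab e) (e :: es) (t :: ts) →
      (t :: ts).Pairwise (· < ·) →
      t + stretch ((e :: es).map (colour lab)) ≤ (t :: ts).getLast (List.cons_ne_nil _ _) + 1 := by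
  induction es with
  | nil =>
    intro e t ts h _
    cases h with
    | cons _ h => cases h; simp [stretch]
  | cons e' es ih =>
    intro e t ts h hp
    cases h with
    | cons h₀ h =>
      cases h with
      | @cons _ t' _ ts h₁ h₂ =>
        have := ih e' t' ts (.cons h₁ h₂) hp.of_cons
        have hlt : t < t' := (List.pairwise_cons.1 hp).1 t' (by simp)
        rw [mem_activeTimes h₀.1] at h₀
        rw [mem_activeTimes h₁.1] at h₁
        simp only [List.map_cons, stretch, List.getLast_cons_cons] at this ⊢
        split_ifs with heq
        · rw [heq] at h₀
          omega
        · omega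

/-- Taking every edge at its first available time, from an arbitrary start, attains the bound. -/
theorem exists_forall₂_eq_stretch {lab : PeriodicLabeling G 2} (es : List (Sym2 V)) :
    ∀ (e : Sym2 V) (t : ℕ), (∀ e' ∈ es, e' ∈ G.edgeSet) → t ∈ activeTimes lab e →
      ∃ ts, List.Forall₂ (fun e t => t ∈ activeTimes lab e) (e :: es) (t :: ts) ∧
        (t :: ts).Pairwise (· < ·) ∧
        (t :: ts).getLast (List.cons_ne_nil _ _) + 1 =
          t + stretch ((e :: es).map (colour lab)) := by
  induction es with
  | nil => exact fun e t _ h => ⟨[], .cons h .nil, by simp, by simp [stretch]⟩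
  | cons e' es ih =>
    intro e t hes h
    have he' : e' ∈ G.edgeSet := hes _ (by simp)
    have h' := (mem_activeTimes h.1 t).1 h
    set d := if colour lab e = colour lab e' then 2 else 1 with hd
    have hpos : 0 < d := by rw [hd]; split_ifs <;> omega
    have hact : t + d ∈ activeTimes lab e' := by
      rw [mem_activeTimes he', hd]
      have := Fin.ext_iff (a := colour lab e) (b := colour lab e')
      refine ⟨by omega, ?_⟩
      split_ifs with heq
      · rw [← heq]; omega
      · rw [this] at heq; omega
    obtain ⟨ts, h₁, h₂, h₃⟩ := ih e' (t + d) (fun _ h => hes _ (by simp [h])) hact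
    refine ⟨(t + d) :: ts, .cons h h₁, List.pairwise_cons.2 ⟨fun b hb => ?_, h₂⟩, ?_⟩
    · rcases List.mem_cons.1 hb with rfl | hb
      · omega
      · have := (List.pairwise_cons.1 h₂).1 b hb
        omega
    · rw [List.getLast_cons_cons, h₃]
      simp only [List.map_cons, stretch, ← hd]
      omega

theorem stretch_le_duration {lab : PeriodicLabeling G 2} {s z : V} (P : TemporalPath lab s z) :
    stretch (P.walk.edges.map (colour lab)) ≤ P.duration := by
  obtain ⟨w, hw, ts, ha, hi⟩ := P
  cases hes : w.edges with
  | nil => simp [stretch]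
  | cons e es =>
    rw [hes] at ha
    cases ha with
    | @cons _ t _ ts h₁ h₂ =>
      have := stretch_le_of_forall₂ es e t ts (.cons h₁ h₂) hi
      have h0 : t ≤ (t :: ts).getLast (List.cons_ne_nil _ _) := by
        rcases List.mem_cons.1 (List.getLast_mem (List.cons_ne_nil t ts)) with h | h
        · exact h.ge
        · exact ((List.pairwise_cons.1 hi).1 _ h).le
      simp only [TemporalPath.duration]
      omega

theorem exists_duration_eq_stretch (lab : PeriodicLabeling G 2) {s z : V} (w : G.Walk s z)
    (hw : w.IsPath) :
    ∃ P : TemporalPath lab s z, P.walk = w ∧ P.duration = stretch (w.edges.map (colour lab)) := by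
  cases hes : w.edges with
  | nil => exact ⟨⟨w, hw, [], by rw [hes]; exact .nil, by simp⟩, rfl, rfl⟩
  | cons e es =>
    have hmem : ∀ e' ∈ e :: es, e' ∈ G.edgeSet := fun e' h => w.edges_subset_edgeSet (hes ▸ h)
    have he : e ∈ G.edgeSet := hmem e (by simp)
    obtain ⟨ts, h₁, h₂, h₃⟩ := exists_forall₂_eq_stretch es e (lab ⟨e, he⟩)
      (fun e' h => hmem e' (by simp [h])) ⟨he, 0, by rw [zero_mul, add_zero]⟩
    refine ⟨⟨w, hw, _, by rw [hes]; exact h₁, h₂⟩, rfl, ?_⟩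
    have h0 : (lab ⟨e, he⟩ : ℕ) ≤ (((lab ⟨e, he⟩ : ℕ) :: ts)).getLast (List.cons_ne_nil _ _) := by
      rcases List.mem_cons.1 (List.getLast_mem (List.cons_ne_nil (lab ⟨e, he⟩ : ℕ) ts)) with h | h
      · exact h.ge
      · exact ((List.pairwise_cons.1 h₂).1 _ h).le
    simp only [TemporalPath.duration]
    omega

/-- In a tree there is only one path to consider for each pair of vertices. -/
theorem realizes_iff (hG : G.IsTree) (lab : PeriodicLabeling G 2) (D : Matrix V V ℕ) :
    Realizes lab D ↔ ∀ (s t : V) (w : G.Walk s t), w.IsPath →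
      stretch (w.edges.map (colour lab)) ≤ D s t := by
  constructor
  · intro h s t w hw
    obtain ⟨P, -, hP⟩ := h s t
    have hPw : P.walk = w := (hG.existsUnique_path s t).unique P.isPath hw
    exact hPw ▸ (stretch_le_duration P).trans hP
  · intro h s t
    obtain ⟨w, hw, hu⟩ := hG.existsUnique_path s t
    obtain ⟨P, -, hP⟩ := exists_duration_eq_stretch lab w hw
    refine ⟨P, fun Q => ?_, hP ▸ h s t w hw⟩
    rw [hP, ← hu Q.walk Q.isPath]
    exact stretch_le_duration Q

end Temporal

namespace SimpleGraph.IsTree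

variable {V : Type*} {G : SimpleGraph V} (hG : G.IsTree)

open scoped Classical in
/-- The contribution of the edge from `x` towards `t`, and of the passage from it to the next edge,
to the duration of a temporal path that leads to `t` through `x`. Here `c v` is the label of the
edge with lower end `v`. -/
noncomputable def hopCost (r : V) (c : V → Fin 2) (t x : V) : ℕ :=
  if x = t then 0
  else 1 + if hG.next t x ≠ t ∧ c (hG.lower r t x) = c (hG.lower r t (hG.next t x)) then 1 else 0

/-- The duration of a fastest temporal path from `s` to `t`, as a sum over the first `m` hops; there
are no contributions once `t` is reached. -/
noncomputable def cost (r : V) (c : V → Fin 2) (s t : V) (m : ℕ) : ℕ :=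
  ∑ i ∈ Finset.range m, hG.hopCost r c t ((hG.next t)^[i] s)

/-- The closed form for the path from `s` to `t` is the sum of the contributions of its hops. -/
theorem stretch_edges_eq_cost (r : V) (c : V → Fin 2) (f : Sym2 V → Fin 2) (t : V)
    (hf : ∀ x, x ≠ t → f s(x, hG.next t x) = c (hG.lower r t x)) {s : V} (w : G.Walk s t)
    (hw : w.IsPath) : ∀ {m : ℕ}, w.length ≤ m →
      Temporal.stretch (w.edges.map f) = hG.cost r c s t m := by
  induction w with
  | nil =>
    intro m _
    rw [cost, Finset.sum_eq_zero]
    · rfl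
    · intro i _
      rw [Function.iterate_fixed (hG.next_self _), hopCost, if_pos rfl]
  | @cons s x t h w ih =>
    intro m hm
    obtain ⟨m, rfl⟩ : ∃ k, m = k + 1 := ⟨m - 1, by rw [Walk.length_cons] at hm; omega⟩
    have hst : s ≠ t := fun e => by
      subst e
      simp at hw
    have hx : hG.next t s = x := by simpa using hG.next_eq_snd hw
    have ih := ih hf hw.of_cons (m := m) (by rw [Walk.length_cons] at hm; omega)
    have hs := hf s hst
    rw [hx] at hs
    rw [cost, Finset.sum_range_succ']
    simp only [Function.iterate_succ_apply, hx, Function.iterate_zero, id]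
    rw [← cost, ← ih]
    classical
    have hhop : hG.hopCost r c t s =
        1 + if x ≠ t ∧ c (hG.lower r t s) = c (hG.lower r t x) then 1 else 0 := by
      rw [hopCost, if_neg hst, hx]
    rw [hhop]
    cases w with
    | nil => simp [Temporal.stretch]
    | @cons _ y _ h' w =>
      have hxt : x ≠ t := fun e => by
        subst e
        simp at hw
      have hy : hG.next t x = y := by simpa using hG.next_eq_snd hw.of_cons
      have hx' := hf x hxt
      rw [hy] at hx'
      simp only [Walk.edges_cons, List.map_cons, Temporal.stretch, hs, hx', hxt, ne_eq,
        not_false_eq_true, true_and]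
      split_ifs <;> omega

/-- Labelings of the edges correspond to labelings of their lower ends. -/
theorem exists_realizes_iff [Fintype V] (r : V) (D : Matrix V V ℕ) {m : ℕ}
    (hm : Fintype.card V ≤ m) :
    (∃ lab : Temporal.PeriodicLabeling G 2, Temporal.Realizes lab D) ↔
      ∃ c : V → Fin 2, ∀ s t, hG.cost r c s t m ≤ D s t := by
  have main (lab : Temporal.PeriodicLabeling G 2) (c : V → Fin 2)
      (h : ∀ t x, x ≠ t → Temporal.colour lab s(x, hG.next t x) = c (hG.lower r t x)) :
      Temporal.Realizes lab D ↔ ∀ s t, hG.cost r c s t m ≤ D s t := by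
    rw [Temporal.realizes_iff hG]
    refine forall_congr' fun s => forall_congr' fun t => ⟨fun hw => ?_, fun hc w hw => ?_⟩
    · obtain ⟨w, hp, -⟩ := hG.existsUnique_path s t
      rw [← hG.stretch_edges_eq_cost r c _ t (h t) w hp (hp.length_lt.le.trans hm)]
      exact hw w hp
    · rwa [hG.stretch_edges_eq_cost r c _ t (h t) w hw (hw.length_lt.le.trans hm)]
  constructor
  · rintro ⟨lab, h⟩
    refine ⟨fun v => Temporal.colour lab s(v, hG.next r v), (main lab _ fun t x hx => ?_).1 h⟩
    rw [(hG.lower_spec hx).2]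
  · rintro ⟨c, h⟩
    have : Nonempty V := ⟨r⟩
    choose! low hlow using fun (e : Sym2 V) (he : e ∈ G.edgeSet) => hG.exists_lower r he
    refine ⟨fun e => ⟨c (low e) + 1, by rw [Set.mem_Icc]; omega⟩, (main _ c fun t x hx => ?_).2 h⟩
    have he : s(x, hG.next t x) ∈ G.edgeSet := hG.adj_next hx
    have h₁ := hlow _ he
    have h₂ := hG.lower_spec (r := r) hx
    rw [← hG.eq_of_edge_eq h₁.1 h₂.1 (h₁.2.symm.trans h₂.2.symm)]
    simp [Temporal.colour, hG.adj_next hx]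

/-- The duration depends only on the labels of the first edge, of the last edge, and of the edges
whose lower end is not a leaf. -/
theorem cost_congr {r : V} {c c' : V → Fin 2} {s t : V} (m : ℕ)
    (h₁ : c (hG.lower r t s) = c' (hG.lower r t s))
    (h₂ : c (hG.lower r s t) = c' (hG.lower r s t)) (h₃ : ∀ v ∈ hG.inner r, c v = c' v) :
    hG.cost r c s t m = hG.cost r c' s t m := by
  have key (i : ℕ) (h : (hG.next t)^[i] s ≠ t) :
      c (hG.lower r t ((hG.next t)^[i] s)) = c' (hG.lower r t ((hG.next t)^[i] s)) := by
    rcases hG.lower_iterate r s t i h with h | h | h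
    · rw [h, h₁]
    · rw [h, h₂]
    · exact h₃ _ h
  refine Finset.sum_congr rfl fun i _ => ?_
  unfold hopCost
  by_cases hi : (hG.next t)^[i] s = t
  · simp [hi]
  by_cases hi' : hG.next t ((hG.next t)^[i] s) = t
  · simp [hi, hi']
  have := key (i + 1) (by rwa [Function.iterate_succ_apply' (hG.next t)])
  rw [Function.iterate_succ_apply' (hG.next t)] at this
  rw [key i hi, this]

end SimpleGraph.IsTree

/-! ### Reduction to 2-satisfiability -/

/-- A 2-CNF formula, given by its implications between literals, is satisfiable unless some literal
and its negation imply each other. -/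
theorem Relation.exists_assignment_iff {L : Type*} [Finite L] (neg : L → L)
    (hneg : ∀ a, neg (neg a) = a) (hne : ∀ a, neg a ≠ a) (r : L → L → Prop)
    (hr : ∀ a b, r a b → r (neg b) (neg a)) :
    (∃ A : Set L, (∀ a, neg a ∈ A ↔ a ∉ A) ∧ ∀ a b, r a b → a ∈ A → b ∈ A) ↔
      ∀ a, ¬ (Relation.TransGen r a (neg a) ∧ Relation.TransGen r (neg a) a) := by
  have hT {a b : L} (h : Relation.ReflTransGen r a b) :
      Relation.ReflTransGen r (neg b) (neg a) := by
    induction h with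
    | refl => exact .refl
    | tail _ h ih => exact .trans (.single (hr _ _ h)) ih
  constructor
  · rintro ⟨A, hA, hrA⟩ a ⟨h₁, h₂⟩
    have closed {a b : L} (h : Relation.TransGen r a b) : a ∈ A → b ∈ A := by
      induction h with
      | single h => exact hrA _ _ h
      | tail _ h ih => exact fun ha => hrA _ _ h (ih ha)
    by_cases ha : a ∈ A
    · exact (hA a).1 (closed h₁ ha) ha
    · exact ha (closed h₂ ((hA a).2 ha))
  · intro h
    -- A maximal consistent set of literals that is closed under implication decides every literal.
    obtain ⟨A, ⟨hA₁, hA₂⟩, hmax⟩ := Set.Finite.exists_maximal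
      (s := {A : Set L | (∀ a ∈ A, neg a ∉ A) ∧ ∀ a b, r a b → a ∈ A → b ∈ A})
      (Set.toFinite _) ⟨∅, by simp⟩
    have closed {a b : L} (h : Relation.ReflTransGen r a b) : a ∈ A → b ∈ A := by
      induction h with
      | refl => exact id
      | tail _ h ih => exact fun ha => hA₂ _ _ h (ih ha)
    refine ⟨A, fun a => ⟨fun h h' => hA₁ a h' h, fun ha => ?_⟩, hA₂⟩
    by_contra hna
    obtain ⟨l, hl, hl', hll⟩ : ∃ l, l ∉ A ∧ neg l ∉ A ∧ ¬ Relation.ReflTransGen r l (neg l) := by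
      have aux {x y : L} (hxy : Relation.ReflTransGen r x y) (hne : x ≠ y) :
          Relation.TransGen r x y :=
        (Relation.reflTransGen_iff_eq_or_transGen.1 hxy).resolve_left hne.symm
      by_cases h₁ : Relation.ReflTransGen r a (neg a)
      · refine ⟨neg a, hna, by rwa [hneg], fun h₂ => h a ⟨aux h₁ (hne a).symm, ?_⟩⟩
        rw [hneg] at h₂
        exact aux h₂ (hne a)
      · exact ⟨a, ha, hna, h₁⟩
    have hsub := hmax (y := A ∪ {x | Relation.ReflTransGen r l x}) ⟨?_, ?_⟩ Set.subset_union_left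
    · exact hl (hsub (.inr .refl))
    · rintro x (hx | hx) (hx' | hx')
      · exact hA₁ x hx hx'
      · exact hl' (closed (hneg x ▸ hT hx' : Relation.ReflTransGen r x (neg l)) hx)
      · exact hl' (closed (hT hx) hx')
      · exact hll (hx'.trans (hT hx))
    · rintro x y hxy (hx | hx)
      · exact .inl (hA₂ x y hxy hx)
      · exact .inr (.tail hx hxy)

namespace SimpleGraph.IsTree

variable {V : Type*} {G : SimpleGraph V} (hG : G.IsTree)

open scoped Classical in
/-- The labels of the edges of the path from `s` to `t` as guessed by `g`, except that the first
edge gets label `a` and the last edge gets label `b`. -/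
noncomputable def override (r : V) (g : V → Fin 2) (s t : V) (a b : Fin 2) : V → Fin 2 :=
  Function.update (Function.update g (hG.lower r t s) a) (hG.lower r s t) b

/-- The implications that a labeling satisfies if it agrees with the guess `g` on the inner vertices
and obeys the bounds `D`. The literal `(v, a)` says that the edge with lower end `v` has label `a`.
Besides the guessed labels, the implications exclude all pairs of labels for the first and the last
edge of a path for which the path takes too long. -/
inductive Implies (r : V) (D : Matrix V V ℕ) (m : ℕ) (g : V → Fin 2) :
    V × Fin 2 → V × Fin 2 → Prop
  | guess (v : V) (hv : v ∈ hG.inner r) : Implies r D m g (v, (g v).rev) (v, g v)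
  | forward (s t : V) (a b : Fin 2) (h : D s t < hG.cost r (hG.override r g s t a b) s t m) :
      Implies r D m g (hG.lower r t s, a) (hG.lower r s t, b.rev)
  | backward (s t : V) (a b : Fin 2) (h : D s t < hG.cost r (hG.override r g s t a b) s t m) :
      Implies r D m g (hG.lower r s t, b) (hG.lower r t s, a.rev)

/-- The 2-CNF formula for the guess `g` is satisfiable. -/
def Consistent (r : V) (D : Matrix V V ℕ) (m : ℕ) (g : V → Fin 2) : Prop :=
  ∀ v, ¬ (Relation.TransGen (hG.Implies r D m g) (v, 0) (v, 1) ∧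
    Relation.TransGen (hG.Implies r D m g) (v, 1) (v, 0))

/-- For a fixed guess the formula expresses that the guess extends to a labeling that obeys the
bounds, because by `cost_congr` the labels other than the first and the last one of a path matter
only if they are guessed. -/
theorem consistent_iff [Finite V] {r : V} {D : Matrix V V ℕ} {m : ℕ} {g : V → Fin 2} :
    hG.Consistent r D m g ↔
      ∃ c : V → Fin 2, (∀ v ∈ hG.inner r, c v = g v) ∧ ∀ s t, hG.cost r c s t m ≤ D s t := by
  have fin_ne {a b : Fin 2} : a ≠ b ↔ a = b.rev := by revert a b; decide
  have h2 := Relation.exists_assignment_iff (L := V × Fin 2) (fun l => (l.1, l.2.rev))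
    (by simp) (fun l h => fin_ne.2 rfl (congrArg Prod.snd h)) (hG.Implies r D m g) (by
      rintro _ _ (⟨v, hv⟩ | ⟨s, t, a, b, h⟩ | ⟨s, t, a, b, h⟩)
      · simpa using Implies.guess v hv
      · simpa using Implies.backward s t a b h
      · simpa using Implies.forward s t a b h)
  have h3 : hG.Consistent r D m g ↔ ∀ a : V × Fin 2,
      ¬ (Relation.TransGen (hG.Implies r D m g) a (a.1, a.2.rev) ∧
        Relation.TransGen (hG.Implies r D m g) (a.1, a.2.rev) a) := by
    refine ⟨fun h ⟨v, a⟩ => ?_, fun h v => h (v, 0)⟩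
    have := h v
    match a with
    | 0 => exact this
    | 1 => exact fun h => this h.symm
  have hover {c : V → Fin 2} (hc : ∀ v ∈ hG.inner r, c v = g v) (s t : V) :
      hG.cost r (hG.override r g s t (c (hG.lower r t s)) (c (hG.lower r s t))) s t m =
        hG.cost r c s t m := by
    have (v : V) (hv : v = hG.lower r t s ∨ v = hG.lower r s t ∨ v ∈ hG.inner r) :
        hG.override r g s t (c (hG.lower r t s)) (c (hG.lower r s t)) v = c v := by
      simp only [override, Function.update_apply]
      split_ifs with h₁ h₂
      · rw [h₁]
      · rw [h₂]
      · exact (hc v ((hv.resolve_left h₂).resolve_left h₁)).symm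
    exact hG.cost_congr m (this _ (.inl rfl)) (this _ (.inr (.inl rfl)))
      fun v hv => this v (.inr (.inr hv))
  rw [h3, ← h2]
  constructor
  · rintro ⟨A, hA, hAr⟩
    choose c hc using fun v : V => show ∃ a : Fin 2, (v, a) ∈ A by
      by_cases h : (v, (0 : Fin 2)) ∈ A
      · exact ⟨0, h⟩
      · exact ⟨1, (hA (v, 0)).2 h⟩
    have huniq {v : V} {a : Fin 2} (h : (v, a) ∈ A) : c v = a := by
      by_contra hne
      have := hc v
      rw [fin_ne.1 hne] at this
      exact (hA (v, a)).1 this h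
    have hcg : ∀ v ∈ hG.inner r, c v = g v := by
      intro v hv
      by_contra hne
      have := hc v
      rw [fin_ne.1 hne] at this
      exact hne (huniq (hAr _ _ (.guess v hv) this))
    refine ⟨c, hcg, fun s t => ?_⟩
    by_contra hlt
    rw [not_le, ← hover hcg s t] at hlt
    exact fin_ne.2 (huniq (hAr _ _ (.forward s t _ _ hlt) (hc _))) rfl
  · rintro ⟨c, hc, hD⟩
    refine ⟨{l | c l.1 = l.2}, fun ⟨v, a⟩ => fin_ne.symm, ?_⟩
    have bad {s t : V} {a b : Fin 2} (h : D s t < hG.cost r (hG.override r g s t a b) s t m)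
        (ha : c (hG.lower r t s) = a) (hb : c (hG.lower r s t) = b) : False := by
      rw [← ha, ← hb, hover hc] at h
      exact absurd (hD s t) (not_le.2 h)
    rintro _ _ (⟨v, hv⟩ | ⟨s, t, a, b, h⟩ | ⟨s, t, a, b, h⟩)
    · exact fun _ => hc v hv
    · exact fun ha => fin_ne.1 fun hb => bad h ha hb
    · exact fun hb => fin_ne.1 fun ha => bad h ha hb

end SimpleGraph.IsTree

/-! ### The algorithm -/

namespace RAM

local infixr:60 " ;; " => Cmd.seq

-- Registers: `n` and `2 * n`, the constant two, loop counters and scratch variables.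
local notation "r_n" => (0 : ℕ)
local notation "r_m" => (1 : ℕ)
local notation "r_two" => (2 : ℕ)
local notation "r_s" => (3 : ℕ)
local notation "r_t" => (4 : ℕ)
local notation "r_k" => (5 : ℕ)
local notation "r_x" => (6 : ℕ)
local notation "r_y" => (7 : ℕ)
local notation "r_a" => (8 : ℕ)
local notation "r_b" => (9 : ℕ)
local notation "r_cost" => (10 : ℕ)
local notation "r_first" => (11 : ℕ)
local notation "r_last" => (12 : ℕ)
local notation "r_c" => (13 : ℕ)
local notation "r_d" => (14 : ℕ)
local notation "r_ok" => (15 : ℕ)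
local notation "r_found" => (16 : ℕ)
local notation "r_carry" => (17 : ℕ)
local notation "r_sq" => (18 : ℕ)
local notation "r_go" => (19 : ℕ)

-- Arrays: the input, next hops (plus one), lower ends of edges, inner vertices, the guess, and the
-- implications between literals.
local notation "a_adj" => (0 : ℕ)
local notation "a_D" => (1 : ℕ)
local notation "a_next" => (2 : ℕ)
local notation "a_lower" => (3 : ℕ)
local notation "a_inner" => (4 : ℕ)
local notation "a_guess" => (5 : ℕ)
local notation "a_imp" => (6 : ℕ)

section

/-- The index of entry `(i, j)` of a matrix of width `w`, for registers `i`, `j` and `w`. -/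
def Expr.idx (i j w : ℕ) : Expr := .reg i * .reg w + .reg j

@[simp] theorem Expr.eval_idx (i j w : ℕ) (s : State) :
    (Expr.idx i j w).eval s = s.reg i * s.reg w + s.reg j := rfl

@[simp] theorem Expr.safe_idx (i j w W : ℕ) (s : State) :
    (Expr.idx i j w).Safe W s ↔ s.reg i * s.reg w + s.reg j ≤ W := by
  simp only [Expr.idx, Expr.safe_add, Expr.safe_mul, Expr.safe_reg, Expr.eval_mul, Expr.eval_reg,
    true_and]
  omega

/-- A nonzero value signals that `a` and `b` differ. -/
def Expr.ne (a b : Expr) : Expr := (a - b) + (b - a)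

@[simp] theorem Expr.eval_ne_eq_zero (a b : Expr) (s : State) :
    (Expr.ne a b).eval s = 0 ↔ a.eval s = b.eval s := by
  simp only [Expr.ne, Expr.eval_add, Expr.eval_sub]
  omega

@[simp] theorem Expr.safe_ne (a b : Expr) (W : ℕ) (s : State) :
    (Expr.ne a b).Safe W s ↔
      a.Safe W s ∧ b.Safe W s ∧ (a.eval s - b.eval s) + (b.eval s - a.eval s) ≤ W := by
  simp only [Expr.ne, Expr.safe_add, Expr.safe_sub, Expr.eval_sub]
  tauto

theorem cell_inj {m n : ℕ} {i i' : Fin m} {j j' : Fin n} :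
    (i : ℕ) * n + j = i' * n + j' ↔ i = i' ∧ j = j' := by
  constructor
  · intro h
    have : finProdFinEquiv (i, j) = finProdFinEquiv (i', j') :=
      Fin.ext (by simp only [finProdFinEquiv_apply_val]; linarith)
    simpa using this
  · rintro ⟨rfl, rfl⟩
    rfl

@[simp] theorem update_cell {m n : ℕ} (f : ℕ → ℕ) (i i' : Fin m) (j j' : Fin n) (v : ℕ) :
    Function.update f (i * n + j) v (i' * n + j') =
      if i' = i ∧ j' = j then v else f (i' * n + j') := by
  rw [Function.update_apply]
  simp only [cell_inj]

theorem cell_lt {m n : ℕ} (i : Fin m) (j : Fin n) : (i : ℕ) * n + j < m * n := by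
  have := (finProdFinEquiv (i, j)).2
  rw [finProdFinEquiv_apply_val] at this
  linarith

/-! ### Computing next hops -/

/-- Enlarge the set of vertices with known next hop towards `t`. -/
def sweepCmd : Cmd :=
  .rep r_x r_n (.rep r_y r_n
    (.ite (.get a_adj (.idx r_x r_y r_n))
      (.ite (.get a_next (.idx r_t r_x r_n))
        (.ite (.get a_next (.idx r_t r_y r_n)) .skip
          (.put a_next (.idx r_t r_y r_n) (.reg r_x + .num 1))) .skip) .skip))

/-- Compute all next hops by searching the tree from every vertex. -/
def nextCmd : Cmd :=
  .rep r_t r_n (.put a_next (.idx r_t r_t r_n) (.reg r_t + .num 1) ;; .rep r_k r_n sweepCmd)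

variable {n : ℕ} {G : SimpleGraph (Fin n)} (hG : G.IsTree) {W B : ℕ}

/-- A partly filled row of the table of next hops, with `0` for unknown values: the set of vertices
whose next hop is known is connected and contains the target. -/
structure PartialRow (t : Fin n) (R : Fin n → ℕ) : Prop where
  eq : ∀ y, R y ≠ 0 → R y = hG.next t y + 1
  self : R t ≠ 0
  closed : ∀ y, R y ≠ 0 → R (hG.next t y) ≠ 0

/-- An unknown neighbor `y` of a known vertex `x` has next hop `x`: the other possibility is that `y`
is the next hop of `x`, but then it is known. -/
theorem PartialRow.update {hG : G.IsTree} {t : Fin n} {R R' : Fin n → ℕ} (h : PartialRow hG t R)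
    {x y : Fin n} (hxy : G.Adj x y) (hx : R x ≠ 0) (hy : R y = 0)
    (hR : ∀ z, R' z = if z = y then (x : ℕ) + 1 else R z) : PartialRow hG t R' := by
  have hyx : hG.next t y = x := (hG.next_eq_or_next_eq t hxy).resolve_left fun e =>
    h.closed x hx (e ▸ hy)
  refine ⟨fun z hz => ?_, ?_, fun z hz => ?_⟩
  · rw [hR] at hz ⊢
    split_ifs at hz ⊢ with hzy
    · rw [hzy, hyx]
    · exact h.eq z hz
  · rw [hR]
    split_ifs
    · omega
    · exact h.self
  · rw [hR] at hz ⊢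
    split_ifs with h₁
    · omega
    · split_ifs at hz with h₂
      · rw [h₂, hyx]; exact hx
      · exact h.closed z hz

/-- After a sweep all neighbors of the vertices that were known before are known. -/
theorem sweepCmd_total (hW : n * n ≤ W) (hB : n ≤ B) {s : State} (hn : s.reg r_n = n)
    {t : Fin n} (ht : s.reg r_t = t)
    (hadj : ∀ x y : Fin n, s.arr a_adj (x * n + y) ≠ 0 ↔ G.Adj x y)
    (hP : PartialRow hG t fun y => s.arr a_next (t * n + y)) :
    sweepCmd.Total W B s fun s' =>
      (PartialRow hG t fun y => s'.arr a_next (t * n + y)) ∧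
      (∀ y : Fin n, s.arr a_next (t * n + y) ≠ 0 → s'.arr a_next (t * n + y) ≠ 0) ∧
      (∀ x y : Fin n, G.Adj x y → s.arr a_next (t * n + x) ≠ 0 → s'.arr a_next (t * n + y) ≠ 0) ∧
      ∀ t' y : Fin n, t' ≠ t → s'.arr a_next (t' * n + y) = s.arr a_next (t' * n + y) := by
  have hnW : n ≤ W := (Nat.le_mul_self n).trans hW
  have hcell (i j : Fin n) : (i : ℕ) * n + j ≤ W := (cell_lt i j).le.trans hW
  -- the part of the claim that holds throughout
  let J (τ : State) : Prop := (PartialRow hG t fun y => τ.arr a_next (t * n + y)) ∧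
      (∀ y : Fin n, s.arr a_next (t * n + y) ≠ 0 → τ.arr a_next (t * n + y) ≠ 0) ∧
      ∀ t' y : Fin n, t' ≠ t → τ.arr a_next (t' * n + y) = s.arr a_next (t' * n + y)
  refine Cmd.Total.rep_fin (fun k τ => J τ ∧ ∀ x y : Fin n, x < k → G.Adj x y →
      s.arr a_next (t * n + x) ≠ 0 → τ.arr a_next (t * n + y) ≠ 0) hn hnW hB
      ⟨⟨hP, by simp, by simp⟩, by simp⟩ ?_ ?_
  · rintro x τ hf hx ⟨hJ, hI⟩
    have hn₁ : τ.reg r_n = n := (hf.reg _ (by decide)).trans hn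
    have ht₁ : τ.reg r_t = t := (hf.reg _ (by decide)).trans ht
    have ha₁ : τ.arr a_adj = s.arr a_adj := hf.arr _ (by decide)
    refine Cmd.Total.rep_fin (fun l τ' => J τ' ∧ (∀ y : Fin n, τ.arr a_next (t * n + y) ≠ 0 →
        τ'.arr a_next (t * n + y) ≠ 0) ∧ ∀ y : Fin n, y < l → G.Adj x y →
        s.arr a_next (t * n + x) ≠ 0 → τ'.arr a_next (t * n + y) ≠ 0) hn₁ hnW hB
        ⟨hJ, by simp, by simp⟩ ?_ ?_
    · rintro y τ' hf' hy ⟨hJ', hM, hI'⟩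
      have hn₂ : τ'.reg r_n = n := (hf'.reg _ (by decide)).trans hn₁
      have ht₂ : τ'.reg r_t = t := (hf'.reg _ (by decide)).trans ht₁
      have hx₂ : τ'.reg r_x = x := (hf'.reg _ (by decide)).trans hx
      have ha₂ : τ'.arr a_adj = s.arr a_adj := (hf'.arr _ (by decide)).trans ha₁
      have step {τ'' : State} (h : J τ'') (hm : ∀ z : Fin n, τ'.arr a_next (t * n + z) ≠ 0 →
          τ''.arr a_next (t * n + z) ≠ 0) (hd : G.Adj x y → s.arr a_next (t * n + x) ≠ 0 →
          τ''.arr a_next (t * n + y) ≠ 0) :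
          J τ'' ∧ (∀ z : Fin n, τ.arr a_next (t * n + z) ≠ 0 → τ''.arr a_next (t * n + z) ≠ 0) ∧
          ∀ z : Fin n, (z : ℕ) < y + 1 → G.Adj x z → s.arr a_next (t * n + x) ≠ 0 →
          τ''.arr a_next (t * n + z) ≠ 0 := by
        refine ⟨h, fun z hz => hm z (hM z hz), fun z hz hadj hs => ?_⟩
        rcases Nat.lt_succ_iff_lt_or_eq.1 hz with hz | hz
        · exact hm z (hI' z hz hadj hs)
        · rw [Fin.ext hz] at hadj ⊢
          exact hd hadj hs
      simp only [Cmd.total_ite, Cmd.total_put, Cmd.total_skip, Expr.eval_idx, Expr.safe_idx,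
        Expr.eval_get, Expr.safe_get, Expr.safe_add, Expr.eval_add, Expr.eval_reg, Expr.safe_reg,
        Expr.eval_num, Expr.safe_num, hn₂, ht₂, hx₂, hy, ha₂, hcell, hadj, true_and]
      refine ⟨fun h₁ => ⟨fun h₂ => ⟨fun h₃ => ?_, fun h₃ => ⟨by omega, ?_⟩⟩, fun h₂ => ?_⟩,
        fun h₁ => ?_⟩
      · exact step hJ' (fun _ h => h) fun _ _ => h₃
      · refine step ⟨hJ'.1.update h₁ h₂ h₃ fun z => by simp, fun z hz => ?_, fun t' z ht' => ?_⟩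
          (fun z hz => ?_) (fun _ _ => ?_)
        · have := hJ'.2.1 z hz
          simp only [State.arr_setReg, State.arr_setArr_self, update_cell]
          split_ifs <;> omega
        · simp [ht', hJ'.2.2 t' z ht']
        · simp only [State.arr_setReg, State.arr_setArr_self, update_cell]
          split_ifs <;> omega
        · simp
      · exact step hJ' (fun _ h => h) fun _ h => absurd h₂ (hJ'.2.1 x h)
      · exact step hJ' (fun _ h => h) fun h => absurd h (not_not.2 h₁ ∘ (hadj x y).2)
    · rintro τ' hf' ⟨hJ', hM, hI'⟩
      refine ⟨hJ', fun z y hz hadj hs => ?_⟩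
      rcases Nat.lt_succ_iff_lt_or_eq.1 hz with hz | hz
      · exact hM y (hI z y hz hadj hs)
      · rw [Fin.ext hz] at hadj hs
        exact hI' y y.2 hadj hs
  · rintro τ hf ⟨⟨h₁, h₂, h₃⟩, hI⟩
    exact ⟨h₁, h₂, fun x y hadj hs => hI x y x.2 hadj hs, h₃⟩

theorem nextCmd_total (hW : n * n + 1 ≤ W) (hB : n ≤ B) {s : State} (hn : s.reg r_n = n)
    (hadj : ∀ x y : Fin n, s.arr a_adj (x * n + y) ≠ 0 ↔ G.Adj x y)
    (h0 : ∀ i, s.arr a_next i = 0) :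
    nextCmd.Total W B s fun s' =>
      ∀ t x : Fin n, s'.arr a_next (t * n + x) = hG.next t x + 1 := by
  have hnW : n ≤ W := (Nat.le_mul_self n).trans (by omega)
  have hcell (i j : Fin n) : (i : ℕ) * n + j ≤ W := (cell_lt i j).le.trans (by omega)
  refine Cmd.Total.rep_fin (fun k τ => (∀ t x : Fin n, t < k →
      τ.arr a_next (t * n + x) = hG.next t x + 1) ∧
      ∀ t x : Fin n, k ≤ t → τ.arr a_next (t * n + x) = 0) hn hnW hB (by simp [h0]) ?_
    fun τ _ h t x => h.1 t x t.2
  rintro t τ hf ht ⟨hdone, htodo⟩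
  have hn₁ : τ.reg r_n = n := (hf.reg _ (by decide)).trans hn
  have ha₁ : τ.arr a_adj = s.arr a_adj := hf.arr _ (by decide)
  rw [Cmd.total_seq]
  simp only [Cmd.total_put, Expr.eval_idx, Expr.safe_idx, Expr.safe_add, Expr.eval_add,
    Expr.eval_reg, Expr.safe_reg, Expr.eval_num, Expr.safe_num, hn₁, ht, hcell, true_and]
  refine ⟨⟨by omega, by omega⟩, ?_⟩
  set τ₁ := τ.setArr a_next (t * n + t) (t + 1) with hτ₁
  have hrow (t' x : Fin n) : τ₁.arr a_next (t' * n + x) =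
      if t' = t ∧ x = t then (t : ℕ) + 1 else τ.arr a_next (t' * n + x) := by simp [hτ₁]
  refine Cmd.Total.rep_fin (fun l σ => (PartialRow hG t fun y => σ.arr a_next (t * n + y)) ∧
      (∀ y : Fin n, G.dist y t ≤ l → σ.arr a_next (t * n + y) ≠ 0) ∧
      ∀ t' y : Fin n, t' ≠ t → σ.arr a_next (t' * n + y) = τ.arr a_next (t' * n + y))
    (n := n) (by simpa [hτ₁] using hn₁) hnW hB ⟨⟨fun y hy => ?_, ?_, fun y hy => ?_⟩, ?_, ?_⟩ ?_ ?_
  · simp only [State.arr_setReg, hrow, htodo t y le_rfl] at hy ⊢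
    by_cases h : y = t <;> simp_all [hG.next_self]
  · simp [hrow]
  · simp only [State.arr_setReg, hrow, htodo t y le_rfl] at hy ⊢
    by_cases h : y = t <;> simp_all [hG.next_self]
  · intro y hy
    have : y = t := (hG.connected.dist_eq_zero_iff (u := y) (v := t)).1 (by omega)
    simp [this, hrow]
  · intro t' y ht'
    simp [hrow, ht']
  · rintro l σ hf' - ⟨h₁, h₂, h₃⟩
    have hn₂ : σ.reg r_n = n := (hf'.reg _ (by decide)).trans hn₁
    have ht₂ : σ.reg r_t = t := (hf'.reg _ (by decide)).trans ht
    have ha₂ : σ.arr a_adj = s.arr a_adj := (hf'.arr _ (by decide)).trans ha₁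
    refine (sweepCmd_total hG (by omega) hB hn₂ ht₂ (ha₂ ▸ hadj) h₁).imp
      fun σ' ⟨g₁, g₂, g₃, g₄⟩ => ⟨g₁, fun y hy => ?_, fun t' y ht' => (g₄ t' y ht').trans
        (h₃ t' y ht')⟩
    by_cases hyt : y = t
    · exact hyt ▸ g₁.self
    · refine g₃ (hG.next t y) y (hG.adj_next hyt).symm (h₂ _ ?_)
      have := hG.dist_next hyt
      omega
  · rintro σ hf' ⟨h₁, h₂, h₃⟩
    refine ⟨fun t' x ht' => ?_, fun t' x ht' => ?_⟩
    · by_cases h : t' = t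
      · subst h
        have hlt : G.dist x t' < n := by
          obtain ⟨p, hp, hl⟩ := hG.connected.exists_path_of_dist x t'
          simpa [hl] using hp.length_lt
        exact h₁.eq x (h₂ x hlt.le)
      · rw [State.arr_setReg, h₃ t' x h]
        exact hdone t' x (by have := Fin.val_ne_of_ne h; omega)
    · have h : t' ≠ t := by rintro rfl; omega
      rw [State.arr_setReg, h₃ t' x h]
      exact htodo t' x (by omega)

end

section

variable {n : ℕ} {G : SimpleGraph (Fin n)} (hG : G.IsTree) {W B : ℕ}

/-! ### Lower ends of edges and inner vertices -/

/-- Compute the lower ends of the edges for the tree rooted at `0`. Row `0` of the table of next hops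
starts at cell `0`, so `a_next[x]` leads from `x` towards the root. -/
def lowerCmd : Cmd :=
  .rep r_t r_n (.rep r_x r_n
    (.ite (.ne (.get a_next (.reg r_x)) (.get a_next (.idx r_t r_x r_n)))
      (.put a_lower (.idx r_t r_x r_n) (.get a_next (.idx r_t r_x r_n) - .num 1))
      (.put a_lower (.idx r_t r_x r_n) (.reg r_x))))

/-- Mark the vertices other than `0` that are the next hop of some vertex on its way to `0`. The mark
of a vertex is its own number, so that the root remains unmarked. -/
def innerCmd : Cmd :=
  .rep r_x r_n (.put a_inner (.get a_next (.reg r_x) - .num 1) (.get a_next (.reg r_x) - .num 1))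

theorem lowerCmd_total (hW : n * n + 1 ≤ W) (hB : n ≤ B) {s : State} (hn : s.reg r_n = n)
    {r : Fin n} (hr : (r : ℕ) = 0)
    (hnext : ∀ t x : Fin n, s.arr a_next (t * n + x) = hG.next t x + 1) :
    lowerCmd.Total W B s fun s' =>
      ∀ t x : Fin n, s'.arr a_lower (t * n + x) = hG.lower r t x := by
  have hnW : n ≤ W := (Nat.le_mul_self n).trans (by omega)
  have hcell (i j : Fin n) : (i : ℕ) * n + j ≤ W := (cell_lt i j).le.trans (by omega)
  have hroot (x : Fin n) : s.arr a_next x = hG.next r x + 1 := by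
    simpa [hr] using hnext r x
  refine (Cmd.Total.rep_forall (fun _ => True) (fun t m => ∀ x : Fin n,
    m a_lower (t * n + x) = hG.lower r t x) hn hnW hB trivial fun t τ hf ht _ => ?_).imp
    fun s' h => h.2
  have hn₁ : τ.reg r_n = n := (hf.reg _ (by decide)).trans hn
  have hx₁ : τ.arr a_next = s.arr a_next := hf.arr _ (by decide)
  refine (Cmd.Total.rep_forall (fun m => ∀ t' x : Fin n, t' ≠ t →
    m a_lower (t' * n + x) = τ.arr a_lower (t' * n + x)) (fun x m =>
    m a_lower (t * n + x) = hG.lower r t x) hn₁ hnW hB (by simp) fun x σ hf' hx hJ => ?_).imp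
    fun σ h => ⟨trivial, h.2, fun t' ht' h' x => (h.1 t' x ht').trans (h' x)⟩
  have hn₂ : σ.reg r_n = n := (hf'.reg _ (by decide)).trans hn₁
  have ht₂ : σ.reg r_t = t := (hf'.reg _ (by decide)).trans ht
  have hx₂ : σ.arr a_next = s.arr a_next := (hf'.arr _ (by decide)).trans hx₁
  have step (v : Fin n) (hv : v = hG.lower r t x) :
      (∀ t' y : Fin n, t' ≠ t → (σ.setArr a_lower (t * n + x) v).arr a_lower (t' * n + y) =
        τ.arr a_lower (t' * n + y)) ∧
      (σ.setArr a_lower (t * n + x) v).arr a_lower (t * n + x) = hG.lower r t x ∧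
      ∀ y : Fin n, y ≠ x → σ.arr a_lower (t * n + y) = hG.lower r t y →
        (σ.setArr a_lower (t * n + x) v).arr a_lower (t * n + y) = hG.lower r t y := by
    refine ⟨fun t' y ht' => ?_, by simp [hv], fun y hy h => ?_⟩
    · simp [ht', hJ t' y ht']
    · simp [hy, h]
  have := (hG.next t x).2
  have := (hG.next r x).2
  simp only [Cmd.total_ite, Cmd.total_put, Expr.eval_ne_eq_zero, Expr.safe_ne, Expr.eval_idx,
    Expr.safe_idx, Expr.eval_get, Expr.safe_get, Expr.eval_sub, Expr.safe_sub, Expr.eval_reg,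
    Expr.safe_reg, Expr.eval_num, Expr.safe_num, hn₂, ht₂, hx₂, hx, hcell, hnext, hroot, true_and,
    ne_eq, Nat.add_right_cancel_iff, ← Fin.ext_iff, Nat.add_sub_cancel]
  refine ⟨by omega, fun h => ⟨by omega, step _ ?_⟩, fun h => step _ ?_⟩
  · simp [SimpleGraph.IsTree.lower, h]
  · simp [SimpleGraph.IsTree.lower, h]

theorem innerCmd_total (hW : n * n + 1 ≤ W) (hB : n ≤ B) {s : State} (hn : s.reg r_n = n)
    {r : Fin n} (hr : (r : ℕ) = 0)
    (hnext : ∀ t x : Fin n, s.arr a_next (t * n + x) = hG.next t x + 1)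
    (h0 : ∀ i, s.arr a_inner i = 0) :
    innerCmd.Total W B s fun s' => ∀ v : Fin n, s'.arr a_inner v ≠ 0 ↔ v ∈ hG.inner r := by
  have hnW : n ≤ W := (Nat.le_mul_self n).trans (by omega)
  have hroot (x : Fin n) : s.arr a_next x = hG.next r x + 1 := by
    simpa [hr] using hnext r x
  refine (Cmd.Total.rep_acc (fun m => m a_inner 0 = 0) (fun m (v : Fin n) => m a_inner v ≠ 0)
    (fun w v => v ≠ r ∧ hG.next r w = v) hn hnW hB (h0 0) fun x τ hf hx hJ => ?_).imp
    fun s' h v => ?_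
  · have hx₁ : τ.arr a_next = s.arr a_next := hf.arr _ (by decide)
    simp only [Cmd.total_put, Expr.eval_get, Expr.safe_get, Expr.eval_sub, Expr.safe_sub,
      Expr.eval_reg, Expr.safe_reg, Expr.eval_num, Expr.safe_num, hx, hx₁, hroot, true_and,
      Nat.add_sub_cancel, State.arr_setArr_self, Function.update_apply, ← Fin.ext_iff]
    refine ⟨by omega, by omega, ?_, fun v => ?_⟩
    · split_ifs with h
      · exact h.symm
      · exact hJ
    · by_cases hv : v = hG.next r x
      · subst hv
        rw [if_pos rfl, ne_eq, ← hr, ← Fin.ext_iff]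
        refine ⟨fun h => .inr ⟨h, rfl⟩, ?_⟩
        rintro (h | h) h'
        · rw [h', hr] at h
          exact h hJ
        · exact h.1 h'
      · simp [hv, Ne.symm hv]
  · simp [h.2, h0, SimpleGraph.IsTree.inner]

end

section

variable {n : ℕ} {G : SimpleGraph (Fin n)} (hG : G.IsTree) {W B : ℕ}

/-! ### Durations of paths -/

/-- What the preprocessing establishes: some constants, and the tables that describe the tree rooted
at `r`. -/
structure Ready (r : Fin n) (D : Matrix (Fin n) (Fin n) ℕ) (s : State) : Prop where
  reg_n : s.reg r_n = n
  reg_m : s.reg r_m = n * 2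
  reg_two : s.reg r_two = 2
  reg_sq : s.reg r_sq = n * 2 * (n * 2)
  bound : ∀ u v : Fin n, s.arr a_D (u * n + v) = D u v
  next : ∀ t x : Fin n, s.arr a_next (t * n + x) = hG.next t x + 1
  lower : ∀ t x : Fin n, s.arr a_lower (t * n + x) = hG.lower r t x
  inner : ∀ v : Fin n, s.arr a_inner v ≠ 0 ↔ v ∈ hG.inner r

variable {hG} {r : Fin n} {D : Matrix (Fin n) (Fin n) ℕ}

theorem Ready.frame {R A : List ℕ} {s s' : State} (h : Ready hG r D s) (hf : Cmd.Frame R A s s')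
    (hR : ∀ x ∈ [r_n, r_m, r_two, r_sq], x ∉ R := by decide)
    (hA : ∀ a ∈ [a_D, a_next, a_lower, a_inner], a ∉ A := by decide) : Ready hG r D s' := by
  simp only [List.forall_mem_cons] at hR hA
  obtain ⟨h₁, h₂, h₃, h₄, -⟩ := hR
  obtain ⟨k₁, k₂, k₃, k₄, -⟩ := hA
  constructor
  · rw [hf.reg _ h₁, h.reg_n]
  · rw [hf.reg _ h₂, h.reg_m]
  · rw [hf.reg _ h₃, h.reg_two]
  · rw [hf.reg _ h₄, h.reg_sq]
  · rw [hf.arr _ k₁]; exact h.bound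
  · rw [hf.arr _ k₂]; exact h.next
  · rw [hf.arr _ k₃]; exact h.lower
  · rw [hf.arr _ k₄]; exact h.inner

/-- Walk from `s` to `t` and count hops and repeated labels. -/
def costCmd : Cmd :=
  .set r_cost (.num 0) ;; .set r_x (.reg r_s) ;; .rep r_k r_n (
    .set r_y (.get a_next (.idx r_t r_x r_n) - .num 1) ;;
    .ite (.ne (.reg r_x) (.reg r_t))
      (.set r_cost (.reg r_cost + .num 1) ;;
        .ite (.ne (.reg r_y) (.reg r_t))
          (.ite (.ne (.get a_guess (.get a_lower (.idx r_t r_x r_n)))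
              (.get a_guess (.get a_lower (.idx r_t r_y r_n)))) .skip
            (.set r_cost (.reg r_cost + .num 1))) .skip) .skip ;;
    .set r_x (.reg r_y))

theorem cost_succ (c : Fin n → Fin 2) (s t : Fin n) (k : ℕ) :
    hG.cost r c s t (k + 1) = hG.cost r c s t k + hG.hopCost r c t ((hG.next t)^[k] s) :=
  Finset.sum_range_succ _ _

theorem cost_le (c : Fin n → Fin 2) (s t : Fin n) (k : ℕ) : hG.cost r c s t k ≤ 2 * k := by
  induction k with
  | zero => simp [SimpleGraph.IsTree.cost]
  | succ k ih =>
    rw [cost_succ, SimpleGraph.IsTree.hopCost]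
    split_ifs <;> omega

theorem costCmd_total (hB : n * 2 * (n * 2) ≤ B) (hW : B ≤ W) {τ : State} (h : Ready hG r D τ)
    {s t : Fin n} (hs : τ.reg r_s = s) (ht : τ.reg r_t = t) {c : Fin n → Fin 2}
    (hc : ∀ v : Fin n, τ.arr a_guess v = c v) :
    costCmd.Total W B τ fun τ' => τ'.reg r_cost = hG.cost r c s t n := by
  have hn := r.pos
  have hnn : n ≤ n * n := Nat.le_mul_self n
  have hnB : n * n * 4 ≤ B := by linarith
  have hcell (i j : Fin n) : (i : ℕ) * n + j ≤ W := (cell_lt i j).le.trans (by omega)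
  simp only [costCmd, Cmd.total_seq, Cmd.total_set, Expr.eval_reg, Expr.safe_reg, Expr.eval_num,
    Expr.safe_num, Nat.zero_le, true_and]
  refine Cmd.Total.rep_fin (fun k σ => σ.reg r_cost = hG.cost r c s t k ∧
    σ.reg r_x = (hG.next t)^[k] s) (n := n) (by simp [h.reg_n]) (by omega) (by omega)
    (by simp [SimpleGraph.IsTree.cost, hs]) ?_ fun σ _ hσ => hσ.1
  rintro k σ hf - ⟨hk, hx⟩
  have hf' : Cmd.Frame [r_cost, r_x, r_k, r_y] [] τ σ :=
    (((Cmd.frame_setReg _ _ _).mono (by simp) (by simp)).trans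
      ((Cmd.frame_setReg _ _ _).mono (by simp) (by simp))).trans
        (hf.mono (by decide) (by decide))
  have h' := h.frame hf'
  have ht' : σ.reg r_t = t := (hf'.reg _ (by decide)).trans ht
  have hc' (v : Fin n) : σ.arr a_guess v = c v := by rw [hf'.arr _ (by decide), hc]
  have hstep := cost_succ (hG := hG) (r := r) c s t k
  have hle := cost_le (hG := hG) (r := r) c s t k
  rw [Function.iterate_succ_apply' (hG.next t)]
  set x := (hG.next t)^[k] s
  have := (hG.next t x).2
  have := x.2
  have := t.2
  have := (c (hG.lower r t x)).2
  have := (c (hG.lower r t (hG.next t x))).2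
  have := k.2
  simp only [Cmd.total_seq, Cmd.total_ite, Cmd.total_set, Cmd.total_skip, Expr.eval_ne_eq_zero,
    Expr.safe_ne, Expr.eval_idx, Expr.safe_idx, Expr.eval_get, Expr.safe_get, Expr.eval_sub,
    Expr.safe_sub, Expr.eval_add, Expr.safe_add, Expr.eval_reg, Expr.safe_reg, Expr.eval_num,
    Expr.safe_num, State.reg_setReg, State.arr_setReg, h'.reg_n, ht', hx, h'.next, h'.lower, hcell, hk,
    hc', true_and, ne_eq, ← Fin.ext_iff, Nat.add_sub_cancel, reduceIte, Nat.reduceEqDiff]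
  rw [SimpleGraph.IsTree.hopCost] at hstep
  refine ⟨by omega, by omega, fun h₁ => ⟨by omega, by omega, fun h₂ => ⟨by omega,
    fun h₃ => ⟨?_, trivial⟩, fun h₃ => ⟨by omega, ?_, trivial⟩⟩, fun h₂ => ⟨?_, trivial⟩⟩,
    fun h₁ => ⟨?_, trivial⟩⟩
  · rw [hstep, if_neg h₁, if_neg (by tauto)]
  · rw [hstep, if_neg h₁, if_pos ⟨h₂, h₃⟩, add_assoc]
  · rw [hstep, if_neg h₁, if_neg (by tauto)]
  · rw [hstep, if_pos h₁, add_zero]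

/-! ### Building the formula -/

/-- The implication between two literals that is stored in array `a_imp`. -/
def Stored (m : ℕ → ℕ → ℕ) (p : (Fin n × Fin 2) × (Fin n × Fin 2)) : Prop :=
  m a_imp (finProdFinEquiv p.1 * (n * 2) + finProdFinEquiv p.2) ≠ 0

/-- Store an implication; its literals are given as vertex and label. -/
def storeCmd (v w : ℕ) (a b : Expr) : Cmd :=
  .set r_x (.reg v * .reg r_two + a) ;; .set r_y (.reg w * .reg r_two + b) ;;
    .put a_imp (.idx r_x r_y r_m) (.num 1)

/-- The literal `(v, a)` has number `2 * v + a`. -/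
theorem lit_eq (v : Fin n) (a : Fin 2) : (v : ℕ) * 2 + a = finProdFinEquiv (v, a) := by
  rw [finProdFinEquiv_apply_val]
  dsimp only
  omega

theorem storeCmd_total (hB : n * 2 * (n * 2) ≤ B) (hW : B ≤ W) {τ : State}
    (hm : τ.reg r_m = n * 2) (h2 : τ.reg r_two = 2) {v w : Fin n} {a b : Fin 2} {rv rw : ℕ}
    {ea eb : Expr} (hv : τ.reg rv = v) (hw : τ.reg rw = w) (ha : ea.eval τ = a)
    (ha' : ea.Safe W τ) (hb : ∀ x, (eb.eval (τ.setReg r_x x)) = b)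
    (hb' : ∀ x, eb.Safe W (τ.setReg r_x x)) (hrw : rw ≠ r_x := by decide) :
    (storeCmd rv rw ea eb).Total W B τ fun τ' =>
      (∀ A, A ≠ a_imp → τ'.arr A = τ.arr A) ∧
      ∀ p, Stored τ'.arr p ↔ Stored τ.arr p ∨ p = ((v, a), (w, b)) := by
  have h₁ := lit_eq v a
  have h₂ := lit_eq w b
  have hc := cell_lt (finProdFinEquiv (v, a)) (finProdFinEquiv (w, b))
  have h₃ := (finProdFinEquiv (v, a)).2
  have h₄ := (finProdFinEquiv (w, b)).2
  have h₅ := Nat.le_mul_self (n * 2)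
  have hn := v.pos
  simp only [storeCmd, Cmd.total_seq, Cmd.total_set, Cmd.total_put, Expr.eval_idx, Expr.safe_idx,
    Expr.eval_mul, Expr.safe_mul, Expr.eval_add, Expr.safe_add, Expr.eval_reg, Expr.safe_reg,
    Expr.eval_num, Expr.safe_num, State.reg_setReg, hv, hw, ha, ha', hb, hb', hm,
    h2, if_neg hrw, h₁, h₂, true_and, reduceIte, Nat.reduceEqDiff]
  refine ⟨⟨by omega, by omega⟩, ⟨by omega, by omega⟩, by omega, by omega, fun A hA => ?_,
    fun p => ?_⟩
  · rw [State.arr_setArr_of_ne _ _ _ _ hA, State.arr_setReg, State.arr_setReg]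
  · simp only [Stored, State.arr_setArr_self, State.arr_setReg, update_cell,
      EmbeddingLike.apply_eq_iff_eq, Prod.ext_iff (x := p)]
    split_ifs with hp <;> simp [hp]

/-- Put the labels `a` and `b` on the first and the last edge of the path from `s` to `t`. -/
def overrideCmd : Cmd :=
  .set r_first (.get a_lower (.idx r_t r_s r_n)) ;;
  .set r_last (.get a_lower (.idx r_s r_t r_n)) ;;
  .set r_c (.get a_guess (.reg r_first)) ;; .put a_guess (.reg r_first) (.reg r_a) ;;
  .set r_d (.get a_guess (.reg r_last)) ;; .put a_guess (.reg r_last) (.reg r_b)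

/-- Undo the effect of `overrideCmd` on the guess. As the two edges may coincide, the old values are
written back in reverse order. -/
def restoreCmd : Cmd :=
  .put a_guess (.reg r_last) (.reg r_d) ;; .put a_guess (.reg r_first) (.reg r_c)

/-- Forbid the labels `a` and `b` for the first and the last edge of the path from `s` to `t`
together if the path takes too long with them. -/
def forbidCmd : Cmd :=
  .ite (.reg r_cost - .get a_D (.idx r_s r_t r_n))
    (storeCmd r_first r_last (.reg r_a) (.num 1 - .reg r_b) ;;
      storeCmd r_last r_first (.reg r_b) (.num 1 - .reg r_a)) .skip

/-- Test one choice of labels for the first and the last edge of a path. -/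
def conflictCmd : Cmd := overrideCmd ;; costCmd ;; restoreCmd ;; forbidCmd

variable (hG r D) in
/-- The implications that come from the path from `s` to `t` with first label `a` and last label
`b`. -/
def Conflict (g : Fin n → Fin 2) (s t : Fin n) (a b : Fin 2)
    (p : (Fin n × Fin 2) × (Fin n × Fin 2)) : Prop :=
  D s t < hG.cost r (hG.override r g s t a b) s t n ∧
    (p = ((hG.lower r t s, a), (hG.lower r s t, b.rev)) ∨
      p = ((hG.lower r s t, b), (hG.lower r t s, a.rev)))

theorem overrideCmd_total (hW : n * n ≤ W) {τ : State} (h : Ready hG r D τ)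
    {s t : Fin n} {a b : Fin 2} (hs : τ.reg r_s = s) (ht : τ.reg r_t = t) (ha : τ.reg r_a = a)
    (hb : τ.reg r_b = b) {u v : Fin n} (hu : hG.lower r t s = u) (hv : hG.lower r s t = v) :
    overrideCmd.Total W B τ fun τ' => τ'.reg r_first = u ∧ τ'.reg r_last = v ∧
      τ'.reg r_c = τ.arr a_guess u ∧ τ'.reg r_d = Function.update (τ.arr a_guess) u a v ∧
      τ'.arr a_guess = Function.update (Function.update (τ.arr a_guess) u a) v b ∧
      τ'.arr a_imp = τ.arr a_imp := by
  have hcell (i j : Fin n) : (i : ℕ) * n + j ≤ W := (cell_lt i j).le.trans hW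
  simp only [overrideCmd, Cmd.total_seq, Cmd.total_set, Cmd.total_put, Expr.eval_idx,
    Expr.safe_idx, Expr.eval_get, Expr.safe_get, Expr.eval_reg, Expr.safe_reg, State.reg_setReg,
    State.arr_setReg, State.reg_setArr, State.arr_setArr_self, h.reg_n, hs, ht, ha, hb, h.lower,
    hcell, true_and, reduceIte, Nat.reduceEqDiff, hu, hv]
  simp

theorem restoreCmd_total {τ : State} {g : ℕ → ℕ} {u v a b : ℕ} (hu : τ.reg r_first = u)
    (hv : τ.reg r_last = v) (hc : τ.reg r_c = g u) (hd : τ.reg r_d = Function.update g u a v)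
    (hg : τ.arr a_guess = Function.update (Function.update g u a) v b) :
    restoreCmd.Total W B τ fun τ' => τ'.arr a_guess = g ∧ τ'.arr a_imp = τ.arr a_imp := by
  simp only [restoreCmd, Cmd.total_seq, Cmd.total_put, Expr.eval_reg, Expr.safe_reg,
    State.reg_setArr, State.arr_setArr_self, hu, hv, hc, hd, hg, true_and]
  simp

theorem one_sub_eq_rev (a : Fin 2) : 1 - (a : ℕ) = (a.rev : ℕ) := by
  rw [Fin.val_rev]
  omega

theorem forbidCmd_total (hB : n * 2 * (n * 2) ≤ B) (hW : B ≤ W) {τ : State} (h : Ready hG r D τ)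
    {g : Fin n → Fin 2} {s t : Fin n} {a b : Fin 2} (hs : τ.reg r_s = s) (ht : τ.reg r_t = t)
    (ha : τ.reg r_a = a) (hb : τ.reg r_b = b) (hu : τ.reg r_first = hG.lower r t s)
    (hv : τ.reg r_last = hG.lower r s t)
    (hc : τ.reg r_cost = hG.cost r (hG.override r g s t a b) s t n) :
    forbidCmd.Total W B τ fun τ' => τ'.arr a_guess = τ.arr a_guess ∧
      ∀ p, Stored τ'.arr p ↔ Stored τ.arr p ∨ Conflict hG r D g s t a b p := by
  have hn := r.pos
  have hnn : n ≤ n * n := Nat.le_mul_self n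
  have hW1 : 1 ≤ W := by linarith
  have hcell (i j : Fin n) : (i : ℕ) * n + j ≤ W := (cell_lt i j).le.trans (by linarith)
  rw [forbidCmd, Cmd.total_ite]
  simp only [Expr.eval_sub, Expr.safe_sub, Expr.eval_get, Expr.safe_get, Expr.eval_idx,
    Expr.safe_idx, Expr.eval_reg, Expr.safe_reg, h.reg_n, hs, ht, h.bound, hc, hcell, true_and,
    Cmd.total_skip, Cmd.total_seq]
  refine ⟨fun hlt => ?_, fun hge p => ?_⟩
  · refine (storeCmd_total (a := a) (b := b.rev) (ea := .reg r_a)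
      (eb := .num 1 - .reg r_b) hB hW h.reg_m h.reg_two hu hv ha trivial
      (fun x => ?_) (fun x => ?_)).imp_frame fun τ₁ hf ⟨a₁, s₁⟩ => ?_
    · exact (congrArg (1 - ·) hb).trans (one_sub_eq_rev b)
    · exact ⟨hW1, trivial⟩
    have reg₁ (x : ℕ) (hx : x ∉ [r_x, r_y]) : τ₁.reg x = τ.reg x :=
      hf.reg x (by simpa [storeCmd, Cmd.regs] using hx)
    have h₁ := h.frame hf
    refine (storeCmd_total (a := b) (b := a.rev) (ea := .reg r_b)
      (eb := .num 1 - .reg r_a) hB hW h₁.reg_m h₁.reg_two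
      ((reg₁ _ (by decide)).trans hv) ((reg₁ _ (by decide)).trans hu)
      ((reg₁ _ (by decide)).trans hb) trivial (fun x => ?_) (fun x => ?_)).imp ?_
    · exact (congrArg (1 - ·) ((reg₁ _ (by decide)).trans ha)).trans (one_sub_eq_rev a)
    · exact ⟨hW1, trivial⟩
    · rintro τ₂ ⟨a₂, s₂⟩
      refine ⟨(a₂ _ (by decide)).trans (a₁ _ (by decide)), fun p => ?_⟩
      rw [s₂, s₁, Conflict, or_assoc, and_iff_right (Nat.lt_of_sub_ne_zero hlt)]
  · rw [Conflict]
    exact (or_iff_left fun h => by omega).symm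

theorem conflictCmd_total (hB : n * 2 * (n * 2) ≤ B) (hW : B ≤ W) {τ : State} (h : Ready hG r D τ)
    {g : Fin n → Fin 2} (hg : ∀ v : Fin n, τ.arr a_guess v = g v) {s t : Fin n} {a b : Fin 2}
    (hs : τ.reg r_s = s) (ht : τ.reg r_t = t) (ha : τ.reg r_a = a) (hb : τ.reg r_b = b) :
    conflictCmd.Total W B τ fun τ' => τ'.arr a_guess = τ.arr a_guess ∧
      ∀ p, Stored τ'.arr p ↔ Stored τ.arr p ∨ Conflict hG r D g s t a b p := by
  rw [conflictCmd, Cmd.total_seq]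
  refine (overrideCmd_total (by linarith) h hs ht ha hb rfl rfl).imp_frame
    fun τ₁ hf₁ ⟨f₁, l₁, c₁, d₁, g₁, i₁⟩ => ?_
  have hR₁ := h.frame hf₁
  have hg₁ (w : Fin n) : τ₁.arr a_guess w = hG.override r g s t a b w := by
    rw [g₁, SimpleGraph.IsTree.override]
    simp only [Function.update_apply, ← Fin.ext_iff, hg]
    split_ifs <;> rfl
  rw [Cmd.total_seq]
  refine (costCmd_total hB hW hR₁ ((hf₁.reg _ (by decide)).trans hs)
    ((hf₁.reg _ (by decide)).trans ht) hg₁).imp_frame fun τ₂ hf₂ hcost => ?_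
  rw [Cmd.total_seq]
  refine (restoreCmd_total ((hf₂.reg _ (by decide)).trans f₁) ((hf₂.reg _ (by decide)).trans l₁)
    ((hf₂.reg _ (by decide)).trans c₁) ((hf₂.reg _ (by decide)).trans d₁)
    ((hf₂.arr _ (by decide)).trans g₁)).imp_frame fun τ₃ hf₃ ⟨g₃, i₃⟩ => ?_
  have hst (p) : Stored τ₃.arr p ↔ Stored (n := n) τ.arr p := by
    simp only [Stored, i₃, hf₂.arr a_imp (by decide), i₁]
  refine (forbidCmd_total (g := g) hB hW ((hR₁.frame hf₂).frame hf₃)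
    (((hf₃.reg _ (by decide)).trans (hf₂.reg _ (by decide))).trans
      ((hf₁.reg _ (by decide)).trans hs))
    (((hf₃.reg _ (by decide)).trans (hf₂.reg _ (by decide))).trans
      ((hf₁.reg _ (by decide)).trans ht))
    (((hf₃.reg _ (by decide)).trans (hf₂.reg _ (by decide))).trans
      ((hf₁.reg _ (by decide)).trans ha))
    (((hf₃.reg _ (by decide)).trans (hf₂.reg _ (by decide))).trans
      ((hf₁.reg _ (by decide)).trans hb))
    (((hf₃.reg _ (by decide)).trans (hf₂.reg _ (by decide))).trans f₁)
    (((hf₃.reg _ (by decide)).trans (hf₂.reg _ (by decide))).trans l₁)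
    ((hf₃.reg _ (by decide)).trans hcost)).imp fun τ₄ ⟨g₄, s₄⟩ => ⟨g₄.trans g₃, fun p => ?_⟩
  rw [s₄, hst]

end

section

variable {n : ℕ} {G : SimpleGraph (Fin n)} {hG : G.IsTree} {r : Fin n}
  {D : Matrix (Fin n) (Fin n) ℕ} {W B : ℕ}

/-- Forget all implications. -/
def clearCmd : Cmd := .rep r_k r_sq (.put a_imp (.reg r_k) (.num 0))

/-- Store the implications that fix the guessed labels. -/
def guessCmd : Cmd :=
  .rep r_k r_n (.ite (.get a_inner (.reg r_k))
    (storeCmd r_k r_k (.num 1 - .get a_guess (.reg r_k)) (.get a_guess (.reg r_k))) .skip)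

/-- Store the implications that come from the bounds on durations. -/
def conflictsCmd : Cmd :=
  .rep r_s r_n (.rep r_t r_n (.rep r_a r_two (.rep r_b r_two conflictCmd)))

/-- Store the formula for the current guess. -/
def formulaCmd : Cmd := clearCmd ;; guessCmd ;; conflictsCmd

theorem clearCmd_total (hB : n * 2 * (n * 2) ≤ B) (hW : B ≤ W) {τ : State} (h : Ready hG r D τ) :
    clearCmd.Total W B τ fun τ' =>
      ∀ p : (Fin n × Fin 2) × (Fin n × Fin 2), ¬ Stored τ'.arr p := by
  refine (Cmd.Total.rep_forall (n := n * 2 * (n * 2)) (fun _ => True)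
    (fun k m => m a_imp k = 0) h.reg_sq (hB.trans hW) hB trivial fun k σ _ hk _ => ?_).imp
    fun τ' hτ' p => ?_
  · simp only [Cmd.total_put, Expr.eval_reg, Expr.safe_reg, Expr.eval_num, Expr.safe_num, hk,
      Nat.zero_le, true_and, State.arr_setArr_self, Function.update_apply]
    exact ⟨if_pos trivial, fun l _ h => by split_ifs; exacts [rfl, h]⟩
  · exact not_not.2 (hτ'.2 ⟨_, cell_lt (finProdFinEquiv p.1) (finProdFinEquiv p.2)⟩)

theorem guessCmd_total (hB : n * 2 * (n * 2) ≤ B) (hW : B ≤ W) {τ : State} (h : Ready hG r D τ)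
    {g : Fin n → Fin 2} (hg : ∀ v : Fin n, τ.arr a_guess v = g v) :
    guessCmd.Total W B τ fun τ' => ∀ p, Stored τ'.arr p ↔ Stored τ.arr p ∨
      ∃ v ∈ hG.inner r, p = ((v, (g v).rev), (v, g v)) := by
  have hn := r.pos
  have hnn : n ≤ n * n := Nat.le_mul_self n
  have hW1 : 1 ≤ W := by linarith
  refine (Cmd.Total.rep_acc (fun m => m a_guess = τ.arr a_guess) Stored
    (fun (v : Fin n) p => v ∈ hG.inner r ∧ p = ((v, (g v).rev), (v, g v))) h.reg_n (by linarith)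
    (by linarith) rfl fun k σ hf hk hJ => ?_).imp fun τ' h => h.2
  have hR := h.frame hf
  simp only [Cmd.total_ite, Cmd.total_skip, Expr.eval_get, Expr.safe_get, Expr.eval_reg,
    Expr.safe_reg, hk, hR.inner, true_and]
  refine ⟨fun hin => ?_, fun hin => ⟨hJ, fun p => ?_⟩⟩
  · refine (storeCmd_total (v := k) (w := k) (a := (g k).rev) (b := g k) hB hW hR.reg_m hR.reg_two
      hk hk ?_ ?_ (fun x => ?_) (fun x => ?_)).imp ?_
    · simp only [Expr.eval_sub, Expr.eval_num, Expr.eval_get, Expr.eval_reg, hk, hJ, hg]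
      exact one_sub_eq_rev _
    · exact ⟨hW1, trivial⟩
    · simp only [Expr.eval_get, Expr.eval_reg, State.reg_setReg, State.arr_setReg, hk, hJ, hg,
        reduceIte, Nat.reduceEqDiff]
    · exact trivial
    · rintro σ' ⟨h₁, h₂⟩
      exact ⟨(h₁ _ (by decide)).trans hJ, fun p => by rw [h₂, and_iff_right hin]⟩
  · exact (or_iff_left fun h' => (hR.inner k).2 h'.1 hin).symm

theorem conflictsCmd_total (hB : n * 2 * (n * 2) ≤ B) (hW : B ≤ W) {τ : State}
    (h : Ready hG r D τ) {g : Fin n → Fin 2} (hg : ∀ v : Fin n, τ.arr a_guess v = g v) :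
    conflictsCmd.Total W B τ fun τ' => τ'.arr a_guess = τ.arr a_guess ∧
      ∀ p, Stored τ'.arr p ↔ Stored τ.arr p ∨ ∃ s t a b, Conflict hG r D g s t a b p := by
  have hn := r.pos
  have hnn : n ≤ n * n := Nat.le_mul_self n
  have hnB : n ≤ B := by linarith
  have h2B : 2 ≤ B := by linarith
  let J (m : ℕ → ℕ → ℕ) : Prop := m a_guess = τ.arr a_guess
  refine Cmd.Total.rep_acc J Stored (fun s p => ∃ t a b, Conflict hG r D g s t a b p) h.reg_n
    (hnB.trans hW) hnB rfl fun s σ₁ hf₁ hs₁ hJ₁ => ?_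
  have hR₁ := h.frame hf₁
  refine Cmd.Total.rep_acc J Stored (fun t p => ∃ a b, Conflict hG r D g s t a b p) hR₁.reg_n
    (hnB.trans hW) hnB hJ₁ fun t σ₂ hf₂ ht₂ hJ₂ => ?_
  have hR₂ := hR₁.frame hf₂
  have hs₂ := (hf₂.reg _ (by decide)).trans hs₁
  refine Cmd.Total.rep_acc J Stored (fun a p => ∃ b, Conflict hG r D g s t a b p) hR₂.reg_two
    (h2B.trans hW) h2B hJ₂ fun a σ₃ hf₃ ha₃ hJ₃ => ?_
  have hR₃ := hR₂.frame hf₃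
  have hs₃ := (hf₃.reg _ (by decide)).trans hs₂
  have ht₃ := (hf₃.reg _ (by decide)).trans ht₂
  refine Cmd.Total.rep_acc J Stored (fun b p => Conflict hG r D g s t a b p) hR₃.reg_two
    (h2B.trans hW) h2B hJ₃ fun b σ₄ hf₄ hb₄ hJ₄ => ?_
  refine (conflictCmd_total hB hW (hR₃.frame hf₄) (fun v => by rw [hJ₄, hg])
    ((hf₄.reg _ (by decide)).trans hs₃) ((hf₄.reg _ (by decide)).trans ht₃)
    ((hf₄.reg _ (by decide)).trans ha₃) hb₄).imp fun σ₅ h₅ => ⟨h₅.1.trans hJ₄, h₅.2⟩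

theorem formulaCmd_total (hB : n * 2 * (n * 2) ≤ B) (hW : B ≤ W) {τ : State} (h : Ready hG r D τ)
    {g : Fin n → Fin 2} (hg : ∀ v : Fin n, τ.arr a_guess v = g v) :
    formulaCmd.Total W B τ fun τ' => τ'.arr a_guess = τ.arr a_guess ∧
      ∀ l l', Stored τ'.arr (l, l') ↔ hG.Implies r D n g l l' := by
  rw [formulaCmd, Cmd.total_seq]
  refine (clearCmd_total hB hW h).imp_frame fun τ₁ hf₁ h₁ => ?_
  have hR₁ := h.frame hf₁
  rw [Cmd.total_seq]
  have hg₁ : τ₁.arr a_guess = τ.arr a_guess := hf₁.arr _ (by decide)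
  refine (guessCmd_total hB hW hR₁ (by simpa only [hg₁] using hg)).imp_frame fun τ₂ hf₂ h₂ => ?_
  have hg₂ : τ₂.arr a_guess = τ.arr a_guess := (hf₂.arr _ (by decide)).trans hg₁
  refine (conflictsCmd_total (g := g) hB hW (hR₁.frame hf₂) (by simpa only [hg₂] using hg)).imp
    fun τ₃ ⟨hg₃, h₃⟩ => ⟨hg₃.trans hg₂, fun l l' => ?_⟩
  rw [h₃, h₂, or_iff_right (h₁ _)]
  constructor
  · rintro (⟨v, hv, he⟩ | ⟨s, t, a, b, hlt, he | he⟩) <;> obtain ⟨rfl, rfl⟩ := Prod.mk.inj he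
    · exact .guess v hv
    · exact .forward s t a b hlt
    · exact .backward s t a b hlt
  · rintro (⟨v, hv⟩ | ⟨s, t, a, b, hlt⟩ | ⟨s, t, a, b, hlt⟩)
    · exact .inl ⟨v, hv, rfl⟩
    · exact .inr ⟨s, t, a, b, hlt, .inl rfl⟩
    · exact .inr ⟨s, t, a, b, hlt, .inr rfl⟩

/-! ### Transitive closure -/

/-- The body of Warshall's algorithm: allow literal `k` as an intermediate point. -/
def viaCmd : Cmd :=
  .rep r_x r_m (.rep r_y r_m
    (.ite (.get a_imp (.idx r_x r_k r_m))
      (.ite (.get a_imp (.idx r_k r_y r_m)) (.put a_imp (.idx r_x r_y r_m) (.num 1)) .skip) .skip))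

/-- Warshall's algorithm. -/
def closureCmd : Cmd := .rep r_k r_m viaCmd

/-- The relation on `Fin M` that is stored in array `a_imp`. -/
def Rel {M : ℕ} (m : ℕ → ℕ → ℕ) (i j : Fin M) : Prop := m a_imp (i * M + j) ≠ 0

theorem viaCmd_total {M : ℕ} (hB : M ≤ B) (hW : M * M ≤ W) {τ : State} (hM : τ.reg r_m = M)
    {k : Fin M} (hk : τ.reg r_k = k) :
    viaCmd.Total W B τ fun τ' => ∀ i j : Fin M,
      Rel τ'.arr i j ↔ Rel τ.arr i j ∨ (Rel τ.arr i k ∧ Rel τ.arr k j) := by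
  have hM0 := k.pos
  have hMW : M ≤ W := (Nat.le_mul_self M).trans hW
  have hcell (i j : Fin M) : (i : ℕ) * M + j ≤ W := (cell_lt i j).le.trans hW
  -- row and column `k` do not change
  let J (m : ℕ → ℕ → ℕ) : Prop := (∀ j : Fin M, Rel m k j ↔ Rel τ.arr k j) ∧
    ∀ i : Fin M, Rel m i k ↔ Rel τ.arr i k
  refine (Cmd.Total.rep_acc J (fun m (p : Fin M × Fin M) => Rel m p.1 p.2)
    (fun i p => ∃ j, p = (i, j) ∧ Rel τ.arr i k ∧ Rel τ.arr k j) hM hMW hB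
    ⟨fun _ => Iff.rfl, fun _ => Iff.rfl⟩ fun x σ hf hx hJ => ?_).imp fun τ' hτ' i j => ?_
  · have hM₁ := (hf.reg _ (by decide)).trans hM
    have hk₁ := (hf.reg _ (by decide)).trans hk
    refine Cmd.Total.rep_acc J (fun m (p : Fin M × Fin M) => Rel m p.1 p.2)
      (fun j p => p = (x, j) ∧ Rel τ.arr x k ∧ Rel τ.arr k j) hM₁ hMW hB hJ
      fun y σ' hf' hy hJ' => ?_
    have hM₂ := (hf'.reg _ (by decide)).trans hM₁
    have hk₂ := (hf'.reg _ (by decide)).trans hk₁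
    have hx₂ := (hf'.reg _ (by decide)).trans hx
    have h₁ := hJ'.2 x
    have h₂ := hJ'.1 y
    unfold Rel at h₁ h₂
    simp only [Cmd.total_ite, Cmd.total_put, Cmd.total_skip, Expr.eval_get, Expr.safe_get,
      Expr.eval_idx, Expr.safe_idx, Expr.eval_num, Expr.safe_num, hM₂, hk₂, hx₂, hy, hcell, true_and,
      h₁, h₂]
    refine ⟨fun g₁ => ⟨fun g₂ => ⟨by omega, ?_⟩, fun g₂ => ⟨hJ', fun p => ?_⟩⟩,
      fun g₁ => ⟨hJ', fun p => ?_⟩⟩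
    · have key (i j : Fin M) : Rel (σ'.setArr a_imp (x * M + y) 1).arr i j ↔
          Rel σ'.arr i j ∨ (i = x ∧ j = y) := by
        simp only [Rel, State.arr_setArr_self, update_cell]
        split_ifs with h <;> simp [h]
      refine ⟨⟨fun j => ?_, fun i => ?_⟩, fun p => ?_⟩
      · rw [key, hJ'.1]
        refine or_iff_left_of_imp ?_
        rintro ⟨rfl, rfl⟩
        exact g₂
      · rw [key, hJ'.2]
        refine or_iff_left_of_imp ?_
        rintro ⟨rfl, rfl⟩
        exact g₁
      · rw [key, Prod.ext_iff]
        exact or_congr_right (and_iff_left ⟨g₁, g₂⟩).symm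
    · exact (or_iff_left fun h => h₂.not.1 (not_not.2 g₂) h.2.2).symm
    · exact (or_iff_left fun h => h₁.not.1 (not_not.2 g₁) h.2.1).symm
  · rw [hτ'.2 (i, j)]
    refine or_congr_right ⟨?_, fun h => ⟨i, j, rfl, h⟩⟩
    rintro ⟨i', j', he, h⟩
    obtain ⟨rfl, rfl⟩ := Prod.mk.inj he
    exact h

theorem closureCmd_total {M : ℕ} (hB : M ≤ B) (hW : M * M ≤ W) {τ : State}
    (hM : τ.reg r_m = M) :
    closureCmd.Total W B τ fun τ' => ∀ i j : Fin M,
      Rel τ'.arr i j ↔ Relation.TransGen (Rel τ.arr) i j := by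
  refine Cmd.Total.rep_fin (fun k σ => (∀ i j : Fin M, Rel τ.arr i j → Rel σ.arr i j) ∧
    (∀ i j : Fin M, Rel σ.arr i j → Relation.TransGen (Rel τ.arr) i j) ∧
    ∀ l : Fin M, l < k → ∀ i j : Fin M, Rel σ.arr i l → Rel σ.arr l j → Rel σ.arr i j) hM
    ((Nat.le_mul_self M).trans hW) hB ⟨fun _ _ => id, fun _ _ => .single, by simp⟩
    (fun k σ hf hk ⟨h₁, h₂, h₃⟩ => ?_) fun σ _ ⟨h₁, h₂, h₃⟩ i j => ⟨h₂ i j, fun h => ?_⟩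
  · refine (viaCmd_total hB hW ((hf.reg _ (by decide)).trans hM) hk).imp fun σ' h' =>
      ⟨fun i j h => (h' i j).2 (.inl (h₁ i j h)), fun i j h => ?_, fun l hl i j hi hj => ?_⟩
    · rcases (h' i j).1 h with h | ⟨g₁, g₂⟩
      · exact h₂ i j h
      · exact (h₂ i k g₁).trans (h₂ k j g₂)
    · rw [State.arr_setReg] at hi hj ⊢
      rw [h'] at hi hj ⊢
      rcases Nat.lt_succ_iff_lt_or_eq.1 hl with hl | hl
      · have g := h₃ l hl
        rcases hi with hi | ⟨hi, hi'⟩ <;> rcases hj with hj | ⟨hj, hj'⟩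
        · exact .inl (g i j hi hj)
        · exact .inr ⟨g i k hi hj, hj'⟩
        · exact .inr ⟨hi, g k j hi' hj⟩
        · exact .inr ⟨hi, hj'⟩
      · obtain rfl := Fin.ext hl
        refine .inr ⟨?_, ?_⟩
        · rcases hi with hi | hi
          exacts [hi, hi.1]
        · rcases hj with hj | hj
          exacts [hj, hj.2]
  · induction h with
    | single h => exact h₁ _ _ h
    | tail _ h ih => exact h₃ _ (Fin.is_lt _) _ _ ih (h₁ _ _ h)

/-! ### Testing satisfiability -/

/-- Test whether some literal and its negation imply each other. -/
def checkCmd : Cmd :=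
  .set r_ok (.num 1) ;; .rep r_k r_n (
    .set r_x (.reg r_k * .reg r_two) ;; .set r_y (.reg r_k * .reg r_two + .num 1) ;;
    .ite (.get a_imp (.idx r_x r_y r_m))
      (.ite (.get a_imp (.idx r_y r_x r_m)) (.set r_ok (.num 0)) .skip) .skip)

theorem checkCmd_total (hB : n * 2 * (n * 2) ≤ B) (hW : B ≤ W) {τ : State} (h : Ready hG r D τ) :
    checkCmd.Total W B τ fun τ' => τ'.reg r_ok ≠ 0 ↔
      ∀ v : Fin n, ¬ (Stored τ.arr ((v, 0), (v, 1)) ∧ Stored τ.arr ((v, 1), (v, 0))) := by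
  have hn := r.pos
  have hnn : n ≤ n * n := Nat.le_mul_self n
  have hcell (i j : Fin (n * 2)) : (i : ℕ) * (n * 2) + j ≤ W :=
    (cell_lt i j).le.trans (hB.trans hW)
  have hW1 : n * 2 ≤ W := by linarith
  simp only [checkCmd, Cmd.total_seq, Cmd.total_set, Expr.eval_num, Expr.safe_num]
  refine ⟨by omega, Cmd.Total.rep_fin (fun k σ => σ.reg r_ok ≠ 0 ↔ ∀ v : Fin n, v < k →
    ¬ (Stored τ.arr ((v, 0), (v, 1)) ∧ Stored τ.arr ((v, 1), (v, 0)))) (n := n)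
    (by simp [h.reg_n]) (by omega) (by linarith) (by simp) (fun k σ hf hk hI => ?_)
    fun σ _ h => by simpa using h⟩
  have hf' : Cmd.Frame [r_ok, r_k, r_x, r_y] [] τ σ :=
    ((Cmd.frame_setReg _ _ _).mono (by simp) (by simp)).trans (hf.mono (by decide) (by decide))
  have hR := h.frame hf'
  have h₀ := lit_eq k 0
  have h₁ := lit_eq k 1
  have hk₁ := k.2
  have step {b : Prop} (hb : b ↔ σ.reg r_ok ≠ 0 ∧
      ¬ (Stored τ.arr ((k, 0), (k, 1)) ∧ Stored τ.arr ((k, 1), (k, 0)))) :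
      b ↔ ∀ v : Fin n, v < (k : ℕ) + 1 →
        ¬ (Stored τ.arr ((v, 0), (v, 1)) ∧ Stored τ.arr ((v, 1), (v, 0))) := by
    rw [hb, hI]
    refine ⟨fun ⟨g₁, g₂⟩ v hv => ?_, fun g => ⟨fun v hv => g v (by omega), g k (by omega)⟩⟩
    rcases Nat.lt_succ_iff_lt_or_eq.1 hv with hv | hv
    · exact g₁ v hv
    · exact Fin.ext hv ▸ g₂
  rw [Fin.val_zero, add_zero] at h₀
  rw [Fin.val_one, h₀] at h₁
  simp only [Cmd.total_seq, Cmd.total_ite, Cmd.total_set, Cmd.total_skip, Expr.eval_get,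
    Expr.safe_get, Expr.eval_idx, Expr.safe_idx, Expr.eval_add, Expr.safe_add, Expr.eval_mul,
    Expr.safe_mul, Expr.eval_num, Expr.safe_num, Expr.eval_reg, Expr.safe_reg, State.reg_setReg,
    State.arr_setReg, hk, hR.reg_two, hR.reg_m, h₀, h₁, hf'.arr a_imp (by decide), hcell, true_and,
    reduceIte, Nat.reduceEqDiff]
  refine ⟨by omega, by omega, fun g₁ => ⟨fun g₂ => ⟨by omega, step ?_⟩, fun g₂ => step ?_⟩,
    fun g₁ => step ?_⟩
  · exact ⟨fun h => absurd rfl h, fun h => absurd ⟨g₁, g₂⟩ h.2⟩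
  · exact (and_iff_left fun h => h.2 g₂).symm
  · exact (and_iff_left fun h => h.1 g₁).symm

end

section

/-! ### Enumerating the guesses -/

section
variable {n : ℕ} (S : Set (Fin n))

open scoped Classical in
/-- The number of elements of `S` below `k`. -/
noncomputable def rank (k : ℕ) : ℕ := Nat.count (fun i => ∃ h : i < n, ⟨i, h⟩ ∈ S) k

open scoped Classical in
/-- The guess with number `N`: the elements of `S` carry the binary digits of `N`. -/
noncomputable def guessAt (N : ℕ) (v : Fin n) : Fin 2 :=
  if v ∈ S then ⟨N / 2 ^ rank S v % 2, Nat.mod_lt _ two_pos⟩ else 0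

open scoped Classical in
theorem rank_succ (v : Fin n) : rank S (v + 1) = rank S v + if v ∈ S then 1 else 0 := by
  simp [rank, Nat.count_succ]

theorem rank_eq_ncard : rank S n = S.ncard := by
  classical
  rw [rank, Nat.count_eq_card_filter_range, ← Set.ncard_image_of_injective S Fin.val_injective,
    ← Set.ncard_coe_finset]
  congr 1
  ext i
  simp only [Finset.coe_filter, Finset.mem_range, Set.mem_ofPred_eq, Set.mem_image]
  constructor
  · rintro ⟨-, h, hS⟩
    exact ⟨_, hS, rfl⟩
  · rintro ⟨v, hv, rfl⟩
    exact ⟨v.2, v.2, hv⟩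

/-- The numbers below `2 ^ rank S n` enumerate all labelings of `S`. -/
theorem exists_guessAt_eq (c : Fin n → Fin 2) :
    ∃ N : ℕ, N < 2 ^ rank S n ∧ ∀ v ∈ S, guessAt S N v = c v := by
  classical
  have key : ∀ k ≤ n, ∃ N : ℕ, N < 2 ^ rank S k ∧
      ∀ v ∈ S, v < k → N / 2 ^ rank S v % 2 = (c v : ℕ) := by
    intro k
    induction k with
    | zero => exact fun _ => ⟨0, by positivity, by simp⟩
    | succ k ih =>
      intro hk
      obtain ⟨N, hN, hc⟩ := ih (by omega)
      have hs := rank_succ S ⟨k, hk⟩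
      dsimp only at hs
      by_cases hkS : (⟨k, hk⟩ : Fin n) ∈ S
      · rw [if_pos hkS] at hs
        have hck := (c ⟨k, hk⟩).2
        refine ⟨N + 2 ^ rank S k * c ⟨k, hk⟩, ?_, fun v hv hvk => ?_⟩
        · rw [hs, pow_succ]
          nlinarith [Nat.mul_le_mul_left (2 ^ rank S k) (Nat.le_of_lt_succ hck)]
        · rcases Nat.lt_succ_iff_lt_or_eq.1 hvk with hvk | hvk
          · have h₁ := rank_succ S v
            rw [if_pos hv] at h₁
            have h₂ : rank S (v + 1) ≤ rank S k := Nat.count_monotone _ hvk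
            obtain ⟨e, he⟩ := Nat.exists_eq_add_of_le (h₁ ▸ h₂)
            have : N + 2 ^ rank S k * c ⟨k, hk⟩ =
                N + 2 ^ rank S v * (2 * (2 ^ e * c ⟨k, hk⟩)) := by
              rw [he]; ring
            rw [this, Nat.add_mul_div_left _ _ (by positivity), Nat.add_mul_mod_self_left]
            exact hc v hv hvk
          · obtain rfl : v = ⟨k, hk⟩ := Fin.ext hvk
            rw [Nat.add_mul_div_left _ _ (by positivity), Nat.div_eq_of_lt hN, zero_add]
            exact Nat.mod_eq_of_lt hck
      · rw [if_neg hkS] at hs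
        refine ⟨N, hs ▸ hN, fun v hv hvk => hc v hv ?_⟩
        rcases Nat.lt_succ_iff_lt_or_eq.1 hvk with hvk | hvk
        · exact hvk
        · exact absurd ((Fin.ext hvk : v = ⟨k, hk⟩) ▸ hv) hkS
  obtain ⟨N, hN, hc⟩ := key n le_rfl
  exact ⟨N, hN, fun v hv => by
    rw [guessAt, if_pos hv]
    exact Fin.ext (hc v hv v.2)⟩

end

/-- Pass to the next guess; a carry is left over after the last one. -/
def nextGuessCmd : Cmd :=
  .set r_carry (.num 1) ;; .rep r_k r_n (
    .ite (.get a_inner (.reg r_k))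
      (.ite (.reg r_carry)
        (.ite (.get a_guess (.reg r_k)) (.put a_guess (.reg r_k) (.num 0))
          (.put a_guess (.reg r_k) (.num 1) ;; .set r_carry (.num 0))) .skip) .skip)

variable {n : ℕ} {G : SimpleGraph (Fin n)} {hG : G.IsTree} {r : Fin n}
  {D : Matrix (Fin n) (Fin n) ℕ} {W B : ℕ}

/-- Incrementing the binary counter leaves a carry exactly if all digits were one. -/
theorem nextGuessCmd_total (hB : n * 2 * (n * 2) ≤ B) (hW : B ≤ W) {τ : State}
    (h : Ready hG r D τ) {N : ℕ}
    (hg : ∀ v : Fin n, τ.arr a_guess v = guessAt (hG.inner r) N v) :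
    nextGuessCmd.Total W B τ fun τ' =>
      τ'.reg r_carry = (if 2 ^ rank (hG.inner r) n ∣ N + 1 then 1 else 0) ∧
      ∀ v : Fin n, τ'.arr a_guess v = guessAt (hG.inner r) (N + 1) v := by
  classical
  have hn := r.pos
  have hnn : n ≤ n * n := Nat.le_mul_self n
  have hW1 : 1 ≤ W := by linarith
  set S := hG.inner r with hS
  simp only [nextGuessCmd, Cmd.total_seq, Cmd.total_set, Expr.eval_num, Expr.safe_num]
  refine ⟨hW1, Cmd.Total.rep_fin (fun k σ =>
    σ.reg r_carry = (if 2 ^ rank S k ∣ N + 1 then 1 else 0) ∧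
    ∀ v : Fin n, σ.arr a_guess v = if v < k then (guessAt S (N + 1) v : ℕ) else guessAt S N v)
    (n := n) (by simp [h.reg_n]) (by linarith) (by linarith)
    (by simpa [rank] using hg) (fun k σ hf hk ⟨hc, hg'⟩ => ?_)
    fun σ _ ⟨hc, hg'⟩ => ⟨hc, fun v => by simpa using hg' v⟩⟩
  have hf' : Cmd.Frame [r_carry, r_k] [a_guess] τ σ :=
    ((Cmd.frame_setReg _ _ _).mono (by simp) (by simp)).trans (hf.mono (by decide) (by decide))
  have hR := h.frame hf'
  have hgk := hg' k
  rw [if_neg (lt_irrefl _)] at hgk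
  -- the new digit and the new carry decide the invariant
  have step {σ' : State} (h₁ : σ'.reg r_carry = if 2 ^ rank S (k + 1) ∣ N + 1 then 1 else 0)
      (h₂ : ∀ v : Fin n, σ'.arr a_guess v =
        if v = k then (guessAt S (N + 1) k : ℕ) else σ.arr a_guess v) :
      (σ'.setReg r_k (k + 1)).reg r_carry = (if 2 ^ rank S (k + 1) ∣ N + 1 then 1 else 0) ∧
      ∀ v : Fin n, (σ'.setReg r_k (k + 1)).arr a_guess v =
        if v < (k : ℕ) + 1 then (guessAt S (N + 1) v : ℕ) else guessAt S N v := by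
    refine ⟨by simpa using h₁, fun v => ?_⟩
    rw [State.arr_setReg, h₂, hg']
    by_cases hvk : v = k
    · simp [hvk]
    · have := Fin.val_ne_of_ne hvk
      rw [if_neg hvk]
      simp only [show (v : ℕ) < k + 1 ↔ (v : ℕ) < k by omega]
  have keep (h : guessAt S (N + 1) k = guessAt S N k) (v : Fin n) : σ.arr a_guess v =
      if v = k then (guessAt S (N + 1) k : ℕ) else σ.arr a_guess v := by
    split_ifs with hvk
    · rw [hvk, h, hgk]
    · rfl
  have hrank := rank_succ S k
  have hdiv : (N + 1) / 2 ^ rank S k = N / 2 ^ rank S k + if 2 ^ rank S k ∣ N + 1 then 1 else 0 :=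
    Nat.succ_div
  simp only [Cmd.total_ite, Cmd.total_put, Cmd.total_set, Cmd.total_seq, Cmd.total_skip,
    Expr.eval_get, Expr.safe_get, Expr.eval_reg, Expr.safe_reg, Expr.eval_num, Expr.safe_num,
    hk, hR.inner, true_and, Nat.zero_le, hW1, ← hS]
  by_cases hkS : k ∈ S
  · have hin : σ.arr a_inner k ≠ 0 := (hR.inner k).2 hkS
    rw [if_pos hkS] at hrank
    have hdvd : 2 ^ rank S (k + 1) ∣ N + 1 ↔
        2 ^ rank S k ∣ N + 1 ∧ N / 2 ^ rank S k % 2 = 1 := by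
      rw [hrank, pow_succ]
      constructor
      · intro hd
        have hd' := (Dvd.intro _ rfl : 2 ^ rank S k ∣ 2 ^ rank S k * 2).trans hd
        rw [if_pos hd'] at hdiv
        refine ⟨hd', ?_⟩
        have := (Nat.dvd_div_iff_mul_dvd hd').2 hd
        omega
      · rintro ⟨hd', hodd⟩
        rw [if_pos hd'] at hdiv
        refine (Nat.dvd_div_iff_mul_dvd hd').1 ?_
        omega
    have hold : (guessAt S N k : ℕ) = N / 2 ^ rank S k % 2 := by rw [guessAt, if_pos hkS]
    have hnew : (guessAt S (N + 1) k : ℕ) =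
        (N / 2 ^ rank S k + if 2 ^ rank S k ∣ N + 1 then 1 else 0) % 2 := by
      rw [guessAt, if_pos hkS, ← hdiv]
    rw [hgk, hold]
    refine ⟨fun _ => ⟨fun h₁ => ⟨fun h₂ => step ?_ ?_, fun h₂ => step ?_ ?_⟩, fun h₁ => step ?_ ?_⟩,
      fun h => absurd h hin⟩
    all_goals
      rw [hc] at h₁
    · rw [State.reg_setArr, hc]
      simp only [hdvd]
      split_ifs at h₁ ⊢ with g₁ g₂ <;> omega
    · intro v
      have hd : 2 ^ rank S k ∣ N + 1 := by by_contra hd; simp [hd] at h₁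
      rw [hnew, if_pos hd, State.arr_setArr_self, Function.update_apply]
      simp only [← Fin.ext_iff]
      split_ifs <;> omega
    · simp only [State.reg_setReg, reduceIte, hdvd, h₂]
      simp
    · intro v
      have hd : 2 ^ rank S k ∣ N + 1 := by by_contra hd; simp [hd] at h₁
      rw [hnew, if_pos hd, State.arr_setReg, State.arr_setArr_self, Function.update_apply]
      simp only [← Fin.ext_iff]
      split_ifs <;> omega
    · have hd : ¬ 2 ^ rank S k ∣ N + 1 := by intro hd; simp [hd] at h₁
      rw [hc, if_neg hd, if_neg (fun h => hd (hdvd.1 h).1)]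
    · have hd : ¬ 2 ^ rank S k ∣ N + 1 := by intro hd; simp [hd] at h₁
      refine keep (Fin.ext ?_)
      rw [hnew, hold, if_neg hd, add_zero]
  · rw [if_neg hkS, add_zero] at hrank
    refine ⟨fun h => absurd h hkS, fun _ => step (hrank ▸ hc) (keep ?_)⟩
    rw [guessAt, guessAt, if_neg hkS, if_neg hkS]

/-! ### The complete program -/

/-- Test the current guess and pass to the next one. -/
def searchCmd : Cmd :=
  formulaCmd ;; closureCmd ;; checkCmd ;; .ite (.reg r_ok) (.set r_found (.num 1)) .skip ;;
    nextGuessCmd ;; .set r_go (.num 1 - .reg r_carry)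

/-- One round with guess number `N`. The control register is cleared after the last guess. -/
theorem searchCmd_total (hB : n * 2 * (n * 2) ≤ B) (hW : B ≤ W) {τ : State} (h : Ready hG r D τ)
    {N : ℕ} (hg : ∀ v : Fin n, τ.arr a_guess v = guessAt (hG.inner r) N v) :
    searchCmd.Total W B τ fun τ' => Ready hG r D τ' ∧
      (∀ v : Fin n, τ'.arr a_guess v = guessAt (hG.inner r) (N + 1) v) ∧
      (τ'.reg r_go = 0 ↔ 2 ^ rank (hG.inner r) n ∣ N + 1) ∧
      (hG.Consistent r D n (guessAt (hG.inner r) N) → τ'.reg r_found = 1) ∧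
      (¬ hG.Consistent r D n (guessAt (hG.inner r) N) → τ'.reg r_found = τ.reg r_found) := by
  have hn := r.pos
  have hW1 : 1 ≤ W := by nlinarith
  have hm := Nat.le_mul_self (n * 2)
  rw [searchCmd, Cmd.total_seq]
  refine (formulaCmd_total hB hW h hg).imp_frame fun τ₁ hf₁ ⟨g₁, h₁⟩ => ?_
  have hR₁ := h.frame hf₁
  rw [Cmd.total_seq]
  refine (closureCmd_total (hm.trans hB) (hB.trans hW) hR₁.reg_m).imp_frame fun τ₂ hf₂ h₂ => ?_
  have hR₂ := hR₁.frame hf₂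
  have hst (l l' : Fin n × Fin 2) : Stored τ₂.arr (l, l') ↔
      Relation.TransGen (hG.Implies r D n (guessAt (hG.inner r) N)) l l' := by
    refine (h₂ (finProdFinEquiv l) (finProdFinEquiv l')).trans ⟨fun h => ?_, fun h => ?_⟩
    · have := Relation.TransGen.lift (p := hG.Implies r D n (guessAt (hG.inner r) N))
        finProdFinEquiv.symm (fun a b hab => (h₁ _ _).1 (by
          simpa only [Stored, Rel, Prod.mk.eta, Equiv.apply_symm_apply] using hab)) _ _ h
      simpa [Function.onFun] using this
    · exact Relation.TransGen.lift finProdFinEquiv (fun a b hab => (h₁ a b).2 hab) _ _ h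
  rw [Cmd.total_seq]
  refine (checkCmd_total hB hW hR₂).imp_frame fun τ₃ hf₃ h₃ => ?_
  have hR₃ := hR₂.frame hf₃
  simp only [hst] at h₃
  change _ ↔ hG.Consistent r D n (guessAt (hG.inner r) N) at h₃
  rw [Cmd.total_seq]
  have h₄ : (Cmd.ite (.reg r_ok) (.set r_found (.num 1)) .skip).Total W B τ₃ fun τ₄ =>
      (hG.Consistent r D n (guessAt (hG.inner r) N) → τ₄.reg r_found = 1) ∧
      (¬ hG.Consistent r D n (guessAt (hG.inner r) N) → τ₄.reg r_found = τ.reg r_found) := by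
    simp only [Cmd.total_ite, Cmd.total_set, Cmd.total_skip, Expr.eval_reg, Expr.safe_reg,
      Expr.eval_num, Expr.safe_num, h₃, hW1, true_and]
    refine ⟨fun hc => ⟨fun _ => rfl, fun h => absurd hc h⟩, fun hc => ?_⟩
    refine ⟨fun h => absurd hc (h₃.2 h), fun _ => ?_⟩
    rw [hf₃.reg _ (by decide), hf₂.reg _ (by decide), hf₁.reg _ (by decide)]
  refine h₄.imp_frame fun τ₄ hf₄ h₄ => ?_
  have hR₄ := hR₃.frame hf₄
  have hg₄ : τ₄.arr a_guess = τ.arr a_guess := by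
    rw [hf₄.arr _ (by decide), hf₃.arr _ (by decide), hf₂.arr _ (by decide), g₁]
  rw [Cmd.total_seq]
  refine (nextGuessCmd_total hB hW hR₄ (N := N) (by simpa only [hg₄] using hg)).imp_frame
    fun τ₅ hf₅ ⟨hc₅, hg₅⟩ => ?_
  have hR₅ := hR₄.frame hf₅
  have hfound : τ₅.reg r_found = τ₄.reg r_found := hf₅.reg _ (by decide)
  rw [Cmd.total_set]
  refine ⟨⟨hW1, trivial⟩, hR₅.frame (Cmd.frame_setReg _ _ _), hg₅, ?_, ?_⟩
  · simp only [State.reg_setReg, reduceIte, Expr.eval_sub, Expr.eval_num, Expr.eval_reg, hc₅]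
    split_ifs with hd <;> simp [hd]
  · simpa [hfound] using h₄

/-- Set up constants and tables. -/
def prepareCmd : Cmd :=
  .set r_two (.num 2) ;; .set r_m (.reg r_n * .reg r_two) ;; .set r_sq (.reg r_m * .reg r_m) ;;
    .set r_go (.num 1) ;; nextCmd ;; lowerCmd ;; innerCmd

theorem prepareCmd_total (hB : n * 2 * (n * 2) ≤ B) (hW : B ≤ W) (hr : (r : ℕ) = 0) {τ : State}
    (hn : τ.reg r_n = n) (hadj : ∀ x y : Fin n, τ.arr a_adj (x * n + y) ≠ 0 ↔ G.Adj x y)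
    (hD : ∀ u v : Fin n, τ.arr a_D (u * n + v) = D u v)
    (h₀ : ∀ A i, A ≠ a_adj → A ≠ a_D → τ.arr A i = 0) :
    prepareCmd.Total W B τ fun τ' => Ready hG r D τ' ∧ τ'.reg r_go = 1 ∧
      τ'.reg r_found = τ.reg r_found ∧ τ'.arr a_guess = τ.arr a_guess := by
  have hn0 := r.pos
  have hm := Nat.le_mul_self (n * 2)
  have hnn := Nat.le_mul_self n
  have hnB : n * n * 4 ≤ B := by linarith
  simp only [prepareCmd, Cmd.total_seq, Cmd.total_set, Expr.eval_mul, Expr.safe_mul, Expr.eval_reg,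
    Expr.safe_reg, Expr.eval_num, Expr.safe_num, State.reg_setReg, hn, true_and, reduceIte,
    Nat.reduceEqDiff]
  refine ⟨by omega, by omega, by omega, by omega, ?_⟩
  set τ₁ := (((τ.setReg r_two 2).setReg r_m (n * 2)).setReg r_sq (n * 2 * (n * 2))).setReg r_go 1
    with hτ₁
  refine (nextCmd_total hG (by omega) (by omega) (s := τ₁) (by simp [hτ₁, hn])
    (by simpa [hτ₁] using hadj) (fun i => h₀ _ i (by decide) (by decide))).imp_frame
    fun τ₂ hf₂ hnext => ?_
  have hn₂ : τ₂.reg r_n = n := (hf₂.reg _ (by decide)).trans (by simp [hτ₁, hn])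
  refine (lowerCmd_total hG (by omega) (by omega) hn₂ hr hnext).imp_frame fun τ₃ hf₃ hlower => ?_
  have hn₃ : τ₃.reg r_n = n := (hf₃.reg _ (by decide)).trans hn₂
  have hx₃ : τ₃.arr a_next = τ₂.arr a_next := hf₃.arr _ (by decide)
  refine (innerCmd_total hG (by omega) (by omega) hn₃ hr (by simpa only [hx₃] using hnext)
    fun i => ?_).imp_frame fun τ₄ hf₄ hinner => ?_
  · rw [hf₃.arr _ (by decide), hf₂.arr _ (by decide)]
    exact h₀ _ i (by decide) (by decide)
  have hreg (x : ℕ) (hx : x ∉ [r_t, r_k, r_x, r_y]) : τ₄.reg x = τ₁.reg x := by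
    rw [hf₄.reg x fun h => hx (by revert h; simp [innerCmd, Cmd.regs]; tauto),
      hf₃.reg x fun h => hx (by revert h; simp [lowerCmd, Cmd.regs]; tauto),
      hf₂.reg x fun h => hx (by revert h; simp [nextCmd, sweepCmd, Cmd.regs])]
  refine ⟨⟨?_, ?_, ?_, ?_, ?_, ?_, ?_, hinner⟩, ?_, ?_, ?_⟩
  · rw [hreg _ (by decide)]; simp [hτ₁, hn]
  · rw [hreg _ (by decide)]; simp [hτ₁]
  · rw [hreg _ (by decide)]; simp [hτ₁]
  · rw [hreg _ (by decide)]; simp [hτ₁]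
  · rw [hf₄.arr _ (by decide), hf₃.arr _ (by decide), hf₂.arr _ (by decide)]
    exact hD
  · rw [hf₄.arr _ (by decide), hx₃]
    exact hnext
  · rw [hf₄.arr _ (by decide)]
    exact hlower
  · rw [hreg _ (by decide)]; simp [hτ₁]
  · rw [hreg _ (by decide)]; simp [hτ₁]
  · rw [hf₄.arr _ (by decide), hf₃.arr _ (by decide), hf₂.arr _ (by decide)]
    rfl

theorem Cmd.Total.exec {c : Cmd} {s : State} {Q : State → Prop} (h : c.Total W B s.view Q) :
    ∃ t s', Exec W c.code s t s' ∧ t ≤ c.time B ∧ Q s'.view := by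
  obtain ⟨t, s', h₁, h₂, h₃⟩ := c.code_exec s h.1
  exact ⟨t, s', h₁, h₂, h₃ ▸ h.2⟩

/-- The complete program: try all guesses, and copy the outcome to the output register. -/
def ttrProgram : Program :=
  .seq prepareCmd.code
    (.seq (.loop (2 * r_go) searchCmd.code) (.copy (2 * r_n) (2 * r_found)))

open scoped Classical in
/-- The main loop, entered with `k` guesses left to try after the first `N`. -/
theorem search_exec (hB : n * 2 * (n * 2) ≤ B) (hW : B ≤ W) :
    ∀ k N, N + k = 2 ^ rank (hG.inner r) n → ∀ s : State, Ready hG r D s.view →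
      (∀ v : Fin n, s.arr a_guess v = guessAt (hG.inner r) N v) → (s.reg (2 * r_go) = 0 ↔ k = 0) →
      s.reg (2 * r_found) =
        (if ∃ M < N, hG.Consistent r D n (guessAt (hG.inner r) M) then 1 else 0) →
      ∃ t s', Exec W (.loop (2 * r_go) searchCmd.code) s t s' ∧ t ≤ k * (searchCmd.time B + 1) + 1 ∧
        s'.reg (2 * r_found) = if ∃ M < 2 ^ rank (hG.inner r) n,
          hG.Consistent r D n (guessAt (hG.inner r) M) then 1 else 0 := by
  intro k
  induction k with
  | zero =>
    intro N hN s _ _ hgo hfound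
    exact ⟨1, s, .loop_done (hgo.2 rfl), by omega, by rw [hfound, ← hN, add_zero]⟩
  | succ k ih =>
    intro N hN s hR hg hgo hfound
    obtain ⟨t₁, s₁, h₁, l₁, hR₁, hg₁, hgo₁, hy, hn⟩ := (searchCmd_total hB hW hR hg).exec
    have hf₁ : s₁.reg (2 * r_found) =
        (if ∃ M < N + 1, hG.Consistent r D n (guessAt (hG.inner r) M) then 1 else 0) := by
      simp only [Nat.lt_succ_iff_lt_or_eq, or_and_right, exists_or, exists_eq_left]
      by_cases hc : hG.Consistent r D n (guessAt (hG.inner r) N)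
      · rw [if_pos (.inr hc)]
        exact hy hc
      · simp only [hc, or_false]
        exact (hn hc).trans hfound
    have hlast : 2 ^ rank (hG.inner r) n ∣ N + 1 ↔ k = 0 := by
      refine ⟨fun hd => ?_, fun hk => by rw [← hN, hk]⟩
      have := Nat.le_of_dvd (by omega) hd
      omega
    obtain ⟨t₂, s₂, h₂, l₂, hf₂⟩ := ih (N + 1) (by omega) s₁ hR₁ hg₁ (hgo₁.trans hlast) hf₁
    exact ⟨_, s₂, .loop_step (fun h => by have := hgo.1 h; omega) h₁ h₂,
      by rw [add_mul]; omega, hf₂⟩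

theorem rowMajor_cell {n : ℕ} (A : Matrix (Fin n) (Fin n) ℕ) (i j : Fin n) :
    rowMajor A (i * n + j) = A i j := by
  have h := cell_lt i j
  have hn := i.pos
  rw [rowMajor, dif_pos h]
  congr 1
  · refine Fin.ext ?_
    change ((i : ℕ) * n + j) / n = i
    rw [Nat.mul_comm, Nat.mul_add_div hn, Nat.div_eq_of_lt j.2, add_zero]
  · refine Fin.ext ?_
    change ((i : ℕ) * n + j) % n = j
    rw [Nat.mul_comm, Nat.mul_add_mod, Nat.mod_eq_of_lt j.2]

/-- Some guess leads to a satisfiable formula if and only if the bounds can be realized. -/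
theorem exists_consistent_iff (hG : G.IsTree) (r : Fin n) :
    (∃ N < 2 ^ rank (hG.inner r) n, hG.Consistent r D n (guessAt (hG.inner r) N)) ↔
      ∃ lab : Temporal.PeriodicLabeling G 2, Temporal.Realizes lab D := by
  rw [hG.exists_realizes_iff r D (m := n) (by simp)]
  simp only [hG.consistent_iff]
  constructor
  · rintro ⟨N, -, c, -, hc⟩
    exact ⟨c, hc⟩
  · rintro ⟨c, hc⟩
    obtain ⟨N, hN, h⟩ := exists_guessAt_eq (hG.inner r) c
    exact ⟨N, hN, c, fun v hv => (h v hv).symm, hc⟩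

theorem ttrProgram_decides (I : TTRInstance) (hΔ : I.Δ = 2) (r : Fin I.n) (hr : (r : ℕ) = 0)
    {W B : ℕ} (hB : I.n * 2 * (I.n * 2) ≤ B) (hW : B ≤ W) :
    Decides ttrProgram I W (prepareCmd.time B +
      (2 ^ (I.isTree.inner r).ncard * (searchCmd.time B + 1) + 2)) := by
  classical
  obtain ⟨n, G, hG, D, hD, Δ, hΔ0⟩ := I
  dsimp only at hΔ r hr hB ⊢
  subst hΔ
  set s := input ⟨n, G, hG, D, hD, 2, hΔ0⟩ with hs
  obtain ⟨t₁, s₁, h₁, l₁, hR, hgo, hfound, hguess⟩ := (prepareCmd_total (hG := hG) (r := r) (D := D)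
    (τ := s.view) hB hW hr (by simp [hs, input])
    (fun x y => by simp [hs, input, rowMajor_cell, SimpleGraph.adjMatrix_apply])
    (fun u v => by simp [hs, input, rowMajor_cell])
    (fun A i h h' => by simp [hs, input, h, h'])).exec
  obtain ⟨t₂, s₂, h₂, l₂, hout⟩ := search_exec hB hW (2 ^ rank (hG.inner r) n) 0 (by omega) s₁ hR
    (fun v => by
      rw [← State.view_arr, hguess]
      have : guessAt (hG.inner r) 0 v = 0 := by
        unfold guessAt
        split_ifs <;> simp
      simp [hs, input, this])
    (by
      have hgo' : s₁.reg (2 * r_go) = 1 := hgo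
      simp [hgo'])
    (by
      have : s₁.reg (2 * r_found) = s.reg (2 * r_found) := hfound
      rw [this]
      simp [hs, input])
  refine ⟨_, _, .seq h₁ (.seq h₂ (.copy _ _ _)), ?_, fun hy => ?_, fun hn => ?_⟩
  · rw [rank_eq_ncard] at l₂
    omega
  · rw [if_pos ((exists_consistent_iff hG r).2 hy)] at hout
    simpa using hout
  · rw [if_neg fun h => hn ((exists_consistent_iff hG r).1 h)] at hout
    simpa using hout

end

/-! ### The running time -/

theorem Decides.mono {P : Program} {I : TTRInstance} {W T T' : ℕ} (h : Decides P I W T)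
    (hT : T ≤ T') : Decides P I W T' := by
  obtain ⟨t, s, h₁, h₂, h₃⟩ := h
  exact ⟨t, s, h₁, h₂.trans hT, h₃⟩

/-- The words are long enough, and up to the number of guesses the running time is polynomial. -/
theorem exists_ttrProgram_decides : ∃ C, 2 ≤ C ∧ ∀ I : TTRInstance, I.Δ = 2 →
    ∃ r : Fin I.n, ∀ W, 4 * I.n ^ 2 ≤ W →
      Decides ttrProgram I W (C * (2 ^ (I.isTree.inner r).ncard * I.n ^ C)) := by
  obtain ⟨K, d, hK⟩ : ∃ K d, ∀ B, 0 < B → prepareCmd.time B ≤ K * B ^ d :=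
    ⟨_, _, fun _ hB => Cmd.time_le hB _⟩
  obtain ⟨K', d', hK'⟩ : ∃ K d, ∀ B, 0 < B → searchCmd.time B ≤ K * B ^ d :=
    ⟨_, _, fun _ hB => Cmd.time_le hB _⟩
  refine ⟨(K + K' + 3) * 4 ^ (d + d') + 2 * (d + d') + 2, by omega, fun I hΔ => ?_⟩
  obtain ⟨r₀⟩ := I.isTree.connected.nonempty
  have hn : 0 < I.n := r₀.pos
  refine ⟨⟨0, hn⟩, fun W hW => (ttrProgram_decides I hΔ ⟨0, hn⟩ rfl (B := 4 * I.n ^ 2)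
    (by nlinarith) hW).mono ?_⟩
  set m := (I.isTree.inner ⟨0, hn⟩).ncard
  set B := 4 * I.n ^ 2 with hB
  have hB0 : 0 < B := by positivity
  have hBd : 1 ≤ B ^ (d + d') := Nat.one_le_pow _ _ hB0
  have h₁ : prepareCmd.time B ≤ K * B ^ (d + d') :=
    (hK B hB0).trans (Nat.mul_le_mul_left _ (Nat.pow_le_pow_right hB0 (by omega)))
  have h₂ : searchCmd.time B ≤ K' * B ^ (d + d') :=
    (hK' B hB0).trans (Nat.mul_le_mul_left _ (Nat.pow_le_pow_right hB0 (by omega)))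
  have hm : 1 ≤ 2 ^ m := Nat.one_le_two_pow
  calc prepareCmd.time B + (2 ^ m * (searchCmd.time B + 1) + 2)
      ≤ 2 ^ m * (K * B ^ (d + d')) + (2 ^ m * (K' * B ^ (d + d') + B ^ (d + d')) +
          2 ^ m * (2 * B ^ (d + d'))) := by
        gcongr
        · exact h₁.trans (Nat.le_mul_of_pos_left _ hm)
        · nlinarith
    _ = 2 ^ m * ((K + K' + 3) * 4 ^ (d + d') * I.n ^ (2 * (d + d'))) := by
        rw [hB, mul_pow, ← pow_mul]; ring
    _ ≤ 2 ^ m * (((K + K' + 3) * 4 ^ (d + d') + 2 * (d + d') + 2) *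
          I.n ^ ((K + K' + 3) * 4 ^ (d + d') + 2 * (d + d') + 2)) := by
        gcongr <;> omega
    _ = _ := by ring

end RAM

theorem theorem3 :
    ∃ (P : RAM.Program) (C : ℕ),
      (∀ I : TTRInstance, I.Δ = 2 →
        RAM.Decides P I (C * (I.n + I.Δ + I.maxD) ^ C) (C * (4 ^ I.vc * I.n ^ C))) ∧
      (∀ I : TTRInstance, I.Δ = 2 → I.IsStar →
        RAM.Decides P I (C * (I.n + I.Δ + I.maxD) ^ C) (C * I.n ^ C)) := by
  obtain ⟨C, hC, h⟩ := RAM.exists_ttrProgram_decides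
  have main (I : TTRInstance) (hΔ : I.Δ = 2) : ∃ r : Fin I.n,
      RAM.Decides RAM.ttrProgram I (2 * C * (I.n + I.Δ + I.maxD) ^ (2 * C))
        (C * (2 ^ (I.isTree.inner r).ncard * I.n ^ (2 * C))) := by
    obtain ⟨r, hr⟩ := h I hΔ
    have hn := r.pos
    refine ⟨r, (hr _ ?_).mono (by gcongr; omega)⟩
    calc 4 * I.n ^ 2 ≤ 2 * C * (I.n + I.Δ + I.maxD) ^ 2 := by gcongr <;> omega
      _ ≤ _ := by gcongr <;> omega
  refine ⟨RAM.ttrProgram, 2 * C, fun I hΔ => ?_, fun I hΔ ⟨c, hc⟩ => ?_⟩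
  · obtain ⟨r, hr⟩ := main I hΔ
    refine hr.mono ?_
    have := I.isTree.ncard_inner_le r
    calc C * (2 ^ (I.isTree.inner r).ncard * I.n ^ (2 * C))
        ≤ 2 * C * (2 ^ (2 * I.vc) * I.n ^ (2 * C)) := by
          gcongr
          · omega
          · norm_num
          · exact this
      _ = _ := by rw [pow_mul]; norm_num
  · obtain ⟨r, hr⟩ := main I hΔ
    refine hr.mono ?_
    have := I.isTree.ncard_inner_le_one r hc
    calc C * (2 ^ (I.isTree.inner r).ncard * I.n ^ (2 * C))
        ≤ C * (2 ^ 1 * I.n ^ (2 * C)) := by gcongr; norm_num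
      _ = _ := by ring
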